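/- Corollary (Generalized Euler–Maclaurin formula with periodic boundary conditions). Let $n,d\ge 1$, let $M\in\mathbb R^{d\times d}$ be symmetric positive definite, let $V=[-\tfrac12,\tfrac12]^d$, and let $f_1,\dots,f_n$ be smooth (real- or complex-valued) functions of $(\mathbf x_1,\dots,\mathbf x_n)\in(\mathbb R^d)^n$. Assume that for each $i$, and for all fixed values of the other variables, $f_i$ is analytic in $\mathbf x_i$ at $\mathbf x_i=\mathbf 0$ and $f_i=\mathcal O(|\mathbf x_i|^{a_i})$ as $\mathbf x_i\to\mathbf 0$, with $a_i\in\mathbb N_0$. Let $p_i\in\mathbb R$ be such that $\gamma_i:=a_i-2p_i>-d$ for all $i$, put $\gamma_{\min}=\min_i\gamma_i$, and define $$g(\mathbf x_1,\dots,\mathbf x_n)=\prod_{i=1}^n\frac{f_i(\mathbf x_1,\dots,\mathbf x_n)}{(\mathbf x_i^TM\mathbf x_i)^{p_i}} .$$ Assume that $g$ and all its partial derivatives satisfy the periodic boundary condition on $\partial V^{\times n}$: each of them takes equal values at any two opposite points of $\partial V^{\times n}$, i.e. points of $V^{\times n}$ that differ only in one of the $nd$ scalar coordinates, which equals $-\tfrac12$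 for the one and $+\tfrac12$ for the other (only points with all $\mathbf x_j\ne\mathbf 0$ being considered, near which $g$ is smooth). For a fixed relative offset $\mathbf x_*\in[0,1]^{nd}$ let $\mathcal X^{(n)}_m$ be the uniform mesh of the $m^{nd}$ points $(-\tfrac12,\dots,-\tfrac12)+\tfrac1m(\mathbf j+\mathbf x_*)$, $\mathbf j\in\{0,\dots,m-1\}^{nd}$, and let $$\mathcal E_{V^{\times n}}(g,\mathcal X^{(n)}_m)=\int_{V^{\times n}}g\,\mathrm d\mathbf x_1\cdots\mathrm d\mathbf x_n-\frac1{m^{nd}}\sum_{\mathbf x\in\mathcal X^{(n)}_m}g(\mathbf x)$$ be the error of the trapezoidal rule, where $g(\mathbf x)$ is set to $0$ at every node with some $\mathbf x_i=\mathbf 0$. Then: 1. for every $nd$-dimensional multi-index $\beta$ with $|\beta|<d+\gamma_{\min}$ the derivative $g^{(\beta)}$ is integrable on $V^{\times n}$, and $\int_{V^{\times n}}g^{(\beta)}\,\mathrm d\mathbf x_1\cdots\mathrm d\mathbf x_n=0$ whenever in addition $|\beta|\ge1$; 2. as $m\to\infty$, $$\mathcal E_{V^{\times n}}(g,\mathcal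 X^{(n)}_m)=\mathcal O\!\left(\frac{\ln m}{m^{d+\gamma_{\min}}}\right).$$ -/

import Mathlib

open MeasureTheory Filter Asymptotics
open scoped ContDiff Matrix

/-- A point `(x₁, …, xₙ)` of `ℝ^d × ⋯ × ℝ^d`: `X i k` is the `k`-th coordinate of `xᵢ`. -/
abbrev Pts (n d : ℕ) : Type := Fin n → Fin d → ℝ

/-- The hypercube `V^{×n}` with `V = [-1/2, 1/2]^d`. -/
def cubeV (n d : ℕ) : Set (Pts n d) :=
  {X | ∀ i k, X i k ∈ Set.Icc (-1 / 2 : ℝ) (1 / 2)}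

/-- The unit vector of `ℝ^{nd}` in the direction of the `k`-th coordinate of `xᵢ`. -/
def unitVec {n d : ℕ} (c : Fin n × Fin d) : Pts n d :=
  Pi.single c.1 (Pi.single c.2 1)

/-- The partial derivative `g^{(β)}` of order `|β| = s`, where the `nd`-dimensional multi-index `β`
is given by the list `c` of the `s` coordinates in which `g` is differentiated (repetitions allowed):
`β` counts how often each coordinate occurs in `c`. -/
noncomputable def mixedPartial {𝕜 : Type*} [RCLike 𝕜] {n d s : ℕ} (c : Fin s → Fin n × Fin d)
    (g : Pts n d → 𝕜) (X : Pts n d) : 𝕜 :=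
  iteratedFDeriv ℝ s g X (fun r => unitVec (c r))

/-- The fractional form `∏ᵢ fᵢ(x₁, …, xₙ) / (xᵢᵀ M xᵢ)^{pᵢ}`. -/
noncomputable def fractionalForm {𝕜 : Type*} [RCLike 𝕜] {n d : ℕ} (f : Fin n → Pts n d → 𝕜)
    (M : Matrix (Fin d) (Fin d) ℝ) (p : Fin n → ℝ) (X : Pts n d) : 𝕜 :=
  ∏ i, f i X / (((X i ⬝ᵥ (M *ᵥ X i)) ^ (p i) : ℝ) : 𝕜)

/-- `g` and all its derivatives take equal values at opposite points of `∂V^{×n}`. The functions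
considered are smooth near the points of `V^{×n}` with all `xⱼ ≠ 0`, and only such points
are compared. -/
def PeriodicBoundary {𝕜 : Type*} [RCLike 𝕜] {n d : ℕ} (g : Pts n d → 𝕜) : Prop :=
  ∀ (i : Fin n) (k : Fin d), ∀ X ∈ cubeV n d, X i k = -1 / 2 → (∀ j, X j ≠ 0) →
    ∀ (s : ℕ) (c : Fin s → Fin n × Fin d),
      mixedPartial c g X = mixedPartial c g (X + unitVec (i, k))

/-- The node with index `j` of the `m^{nd}`-sized uniform mesh in `V^{×n}` with relative
offset `x`. -/
noncomputable def meshNode {n d m : ℕ} (x : Pts n d) (j : Fin n → Fin d → Fin m) : Pts n d :=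
  fun i k => -1 / 2 + (((j i k : ℕ) : ℝ) + x i k) / (m : ℝ)

/-- The trapezoidal rule over `V^{×n}` (a cube of volume one): the average of the values at the
`m^{nd}` mesh nodes. -/
noncomputable def trapezoidalRule {𝕜 : Type*} [RCLike 𝕜] {n d : ℕ} (m : ℕ) (x : Pts n d)
    (g : Pts n d → 𝕜) : 𝕜 :=
  (∑ j : Fin n → Fin d → Fin m, g (meshNode x j)) / (m : 𝕜) ^ (n * d)

open Classical in
/-- `g`, with the value replaced by `0` where some `xᵢ = 0`. -/
noncomputable def zeroAtSingular {𝕜 : Type*} [RCLike 𝕜] {n d : ℕ} (g : Pts n d → 𝕜)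
    (X : Pts n d) : 𝕜 :=
  if ∃ i, X i = 0 then 0 else g X

/-- The quadrature error `∫_{V^{×n}} g - Q(g)`; nodes with some `xᵢ = 0` contribute `0`
to the quadrature. -/
noncomputable def quadratureError {𝕜 : Type*} [RCLike 𝕜] {n d : ℕ} (m : ℕ) (x : Pts n d)
    (g : Pts n d → 𝕜) : 𝕜 :=
  (∫ X in cubeV n d, g X) - trapezoidalRule m x (zeroAtSingular g)

/-!
The function `g = fractionalForm f M p` behaves like a homogeneous symbol in each point `xᵢ`
separately. Since `fᵢ` is analytic in `xᵢ` at the origin and `O(‖xᵢ‖ ^ aᵢ)` for all values of the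
other points, all its `xᵢ`-derivatives of order less than `aᵢ` vanish on `{xᵢ = 0}`
(`vanishOrder_of_isBigO`), and Taylor's theorem in `xᵢ` makes the bound uniform
(`VanishOrder.exists_norm_le`). Together with the corresponding fact for powers of the quadratic
form this gives `|∂^β g| ≤ C ∏ᵢ ‖xᵢ‖ ^ (γᵢ - |βᵢ|)` on `V^{×n}`, where `βᵢ` is the part of `β` that
acts on `xᵢ` (`isSymbol_fractionalForm`, with the calculus of `IsSymbol`).

The singularities are cut off at a scale `ε`: `g_ε = g · ∏ᵢ χ(xᵢ / ε)` with `χ = 0` near the origin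
and `χ = 1` outside the unit ball. The functions `g_ε` are smooth, satisfy the same symbol estimates
as `g` uniformly in `ε` (`isSymbol_cutProd`), and inherit the periodic boundary condition
(`ptsFaceMatch_mixedPartial_cutProd`).

* If `|β| < d + γmin`, all exponents `γᵢ - |βᵢ|` exceed `-d`, so the weight is integrable and
  dominates `∂^β g_ε` uniformly. As `∂^β g_ε` integrates to zero for `|β| ≥ 1` by the fundamental
  theorem of calculus, so does `∂^β g`, by dominated convergence as `ε → 0`.

* For the quadrature error take `ε = κ / m`. As the offset of the mesh is fixed, `κ > 0` can be
  chosen such that at every mesh point each `xᵢ` is either zero or at distance at least `κ / m` from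
  zero (`exists_meshNode_gap`); hence the trapezoidal rule does not see the difference between
  `g_ε` and `g` with its singular values set to zero. The integral of `g - g_ε` is controlled by the
  integral of the weight over `{‖xᵢ‖ < ε}`, which is `O(m ^ (-(γᵢ + d)))`. The trapezoidal error of
  the smooth periodic function `g_ε` is at most a constant times
  `m ^ (-N) ∑_c ∫ |∂_c^N g_ε|` for large `N` (`exists_trapezoid_error_le`): in the Fourier series
  only the frequencies in `m ℤ^{nd}` survive the averaging over the mesh. If `N` exceeds `γᵢ + d` and
  `c` is a coordinate of `xᵢ`, that integral is dominated by its part near `‖xᵢ‖ = ε` and has size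
  `ε ^ (γᵢ + d - N)`, so that again `m ^ (-(γᵢ + d))` remains.

With cutoffs that follow the mesh, the logarithm in the asserted bound is not needed.
-/

/-! ### Directional derivatives and the fundamental theorem of calculus on a cube -/

/-- The derivative of `u` in the constant direction `v`, as a function. -/
noncomputable def dirDeriv {W E : Type*} [NormedAddCommGroup W] [NormedSpace ℝ W]
    [NormedAddCommGroup E] [NormedSpace ℝ E] (v : W) (u : W → E) (X : W) : E :=
  fderiv ℝ u X v

section dirDeriv

variable {W W' E F : Type*} [NormedAddCommGroup W] [NormedSpace ℝ W] [NormedAddCommGroup W']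
  [NormedSpace ℝ W'] [NormedAddCommGroup E] [NormedSpace ℝ E] [NormedAddCommGroup F]
  [NormedSpace ℝ F]

theorem contDiff_dirDeriv (v : W) {u : W → E} (hu : ContDiff ℝ ∞ u) :
    ContDiff ℝ ∞ (dirDeriv v u) :=
  (hu.fderiv_right (m := ∞) (by simp)).clm_apply contDiff_const

theorem contDiff_iterate_dirDeriv (v : W) {u : W → E} (hu : ContDiff ℝ ∞ u) (k : ℕ) :
    ContDiff ℝ ∞ ((dirDeriv v)^[k] u) := by
  induction k with
  | zero => exact hu
  | succ k ih =>
    rw [Function.iterate_succ_apply']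
    exact contDiff_dirDeriv v ih

theorem dirDeriv_comp_equiv (L : W ≃L[ℝ] W') (v : W) (u : W' → E) :
    dirDeriv v (u ∘ L) = dirDeriv (L v) u ∘ L := by
  funext X
  simp [dirDeriv, L.comp_right_fderiv]

theorem iterate_dirDeriv_comp_equiv (L : W ≃L[ℝ] W') (v : W) (u : W' → E) (k : ℕ) :
    (dirDeriv v)^[k] (u ∘ L) = (dirDeriv (L v))^[k] u ∘ L := by
  induction k with
  | zero => rfl
  | succ k ih => rw [Function.iterate_succ_apply', ih, dirDeriv_comp_equiv,
      Function.iterate_succ_apply']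

theorem dirDeriv_clm_comp (L : E →L[ℝ] F) (v : W) {u : W → E} {X : W}
    (hu : DifferentiableAt ℝ u X) :
    dirDeriv v (fun Y => L (u Y)) X = L (dirDeriv v u X) := by
  have : fderiv ℝ (fun Y => L (u Y)) X = L.comp (fderiv ℝ u X) :=
    (L.hasFDerivAt.comp X hu.hasFDerivAt).fderiv
  simp [dirDeriv, this]

theorem iterate_dirDeriv_clm_comp (L : E →L[ℝ] F) (v : W) {u : W → E} (hu : ContDiff ℝ ∞ u)
    (k : ℕ) :
    (dirDeriv v)^[k] (fun Y => L (u Y)) = fun Y => L ((dirDeriv v)^[k] u Y) := by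
  induction k with
  | zero => rfl
  | succ k ih =>
    rw [Function.iterate_succ_apply', ih, Function.iterate_succ_apply']
    funext X
    exact dirDeriv_clm_comp L v
      ((contDiff_iterate_dirDeriv v hu k).differentiable (by simp) X)

end dirDeriv

/-- The cube `[-1/2, 1/2]^ι`. -/
def unitCube (ι : Type*) : Set (ι → ℝ) := {x | ∀ c, x c ∈ Set.Icc (-1 / 2 : ℝ) (1 / 2)}

section cube

variable {ι : Type*}

theorem unitCube_eq_Icc : unitCube ι = Set.Icc (fun _ => (-1 / 2 : ℝ)) (fun _ => 1 / 2) := by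
  ext x
  simp [unitCube, Set.mem_Icc, Pi.le_def, forall_and]

theorem isCompact_unitCube : IsCompact (unitCube ι) := by
  rw [unitCube_eq_Icc, ← Set.pi_univ_Icc]
  exact isCompact_univ_pi fun _ => isCompact_Icc

variable [Fintype ι] [DecidableEq ι]

/-- The divergence theorem for the vector field with the single component `u` in direction `c`. -/
theorem integral_dirDeriv_unitCube_eq_zero {E : Type*} [NormedAddCommGroup E] [NormedSpace ℝ E]
    {u : (ι → ℝ) → E} (hu : ContDiff ℝ 1 u) (c : ι)
    (hmatch : ∀ X ∈ unitCube ι, X c = -1 / 2 → u X = u (X + Pi.single c 1)) :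
    ∫ X in unitCube ι, dirDeriv (Pi.single c 1) u X = 0 := by
  obtain ⟨k, hk⟩ : ∃ k, Fintype.card ι = k + 1 :=
    Nat.exists_eq_succ_of_ne_zero (Fintype.card_pos_iff.2 ⟨c⟩).ne'
  let e : ι ≃ Fin (k + 1) := Fintype.equivFinOfCardEq hk
  let eL : (ι → ℝ) ≃L[ℝ] (Fin (k + 1) → ℝ) :=
    ContinuousLinearEquiv.piCongrLeft ℝ (fun _ : Fin (k + 1) => ℝ) e
  have heL : ∀ x j, eL x j = x (e.symm j) := by
    intro x j
    obtain ⟨i, rfl⟩ := e.surjective j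
    rw [e.symm_apply_apply]
    exact Equiv.piCongrLeft_apply_apply (P := fun _ : Fin (k+1) => ℝ) e x i
  have heLs : ∀ y i, eL.symm y i = y (e i) := by
    intro y i
    have := heL (eL.symm y) (e i)
    simpa using this.symm
  have hu1 : Differentiable ℝ u := hu.differentiable (by simp)
  have hcont : Continuous (dirDeriv (Pi.single c 1) u) := by
    unfold dirDeriv
    exact (hu.continuous_fderiv (by simp)).clm_apply continuous_const
  rw [unitCube_eq_Icc]
  have key := integral_divergence_of_hasFDerivAt_off_countable_of_equiv (E := E) eL
    (fun x y => by
      simp only [Pi.le_def, heL]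
      exact ⟨fun h i => by simpa using h (e i), fun h j => h _⟩)
    (volume_measurePreserving_piCongrLeft (fun _ : Fin (k + 1) => ℝ) e)
    (fun j => if j = e c then u else 0)
    (fun j x => if j = e c then fderiv ℝ u x else 0) ∅ Set.countable_empty
    (fun _ => (-1 / 2 : ℝ)) (fun _ => 1 / 2) (fun _ => by norm_num)
    (fun j => by
      split_ifs
      · exact hu.continuous.continuousOn
      · exact continuousOn_const)
    (fun x _ j => by
      split_ifs
      · exact (hu1 x).hasFDerivAt
      · exact hasFDerivAt_const _ _)
    (dirDeriv (Pi.single c 1) u)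
    (fun x => by
      have h1 : eL.symm (Pi.single (e c) 1) = Pi.single c 1 := by
        funext i
        rw [heLs]
        by_cases h : i = c
        · subst h; simp
        · rw [Pi.single_eq_of_ne h, Pi.single_eq_of_ne (by simpa using h)]
      rw [Finset.sum_eq_single (e c)]
      · simp [h1, dirDeriv]
      · intro j _ hj; simp [hj]
      · simp)
    (hcont.continuousOn.integrableOn_compact (by rw [← unitCube_eq_Icc]; exact isCompact_unitCube))
  rw [key]
  -- Only the faces orthogonal to `c` contribute, and there the values of `u` cancel.
  refine Finset.sum_eq_zero fun j _ => ?_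
  by_cases hj : j = e c
  · rw [sub_eq_zero]
    refine setIntegral_congr_fun measurableSet_Icc fun y hy => ?_
    simp only [hj, if_true]
    subst hj
    have hval : ∀ t : ℝ, ∀ i, eL.symm ((e c).insertNth t y) i
        = if i = c then t else eL.symm ((e c).insertNth 0 y) i := by
      intro t i
      split_ifs with hi
      · subst hi; rw [heLs]; simp
      · rw [heLs, heLs]
        obtain ⟨l, hl⟩ := Fin.exists_succAbove_eq (x := e i) (y := e c) (by simpa using hi)
        rw [← hl]; simp
    have h2 := hmatch (eL.symm ((e c).insertNth (-1/2) y)) (by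
      intro i
      rw [heLs]
      by_cases hi : i = c
      · subst hi; simp; norm_num
      · obtain ⟨l, hl⟩ := Fin.exists_succAbove_eq (x := e i) (y := e c) (by simpa using hi)
        rw [← hl]
        have h1 := hy.1 l
        have h2 := hy.2 l
        simp only [Function.comp, heL] at h1 h2
        simp only [Fin.insertNth_apply_succAbove]
        exact ⟨h1, h2⟩) (by rw [heLs]; simp)
    simp only [heL]
    rw [h2]
    congr 1
    funext i
    rw [Pi.add_apply, hval, hval (-1/2)]
    by_cases hi : i = c
    · subst hi; simp; norm_num
    · simp [hi]
  · simp [hj]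

end cube

/-! ### Fourier coefficients over the cube -/

section fourier

variable {ι : Type*} [Fintype ι]

/-- The plane wave `x ↦ exp (2πi k·x)`. -/
noncomputable def planeWave (k : ι → ℤ) (x : ι → ℝ) : ℂ :=
  Complex.exp (2 * Real.pi * Complex.I * ((∑ i, (k i : ℝ) * x i : ℝ) : ℂ))

theorem planeWave_eq_prod (k : ι → ℤ) (x : ι → ℝ) :
    planeWave k x = ∏ i, Complex.exp (2 * Real.pi * Complex.I * k i * x i) := by
  rw [planeWave, ← Complex.exp_sum]
  push_cast
  rw [Finset.mul_sum]
  simp only [mul_assoc]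

theorem mFourier_coe (k : ι → ℤ) (x : ι → ℝ) :
    UnitAddTorus.mFourier k (fun i => (x i : UnitAddCircle)) = planeWave k x := by
  rw [planeWave_eq_prod]
  simp only [UnitAddTorus.mFourier, ContinuousMap.coe_mk]
  refine Finset.prod_congr rfl fun i _ => ?_
  rw [fourier_coe_apply]
  simp

theorem norm_planeWave (k : ι → ℤ) (x : ι → ℝ) : ‖planeWave k x‖ = 1 := by
  rw [planeWave, Complex.norm_exp]
  simp

theorem contDiff_planeWave (k : ι → ℤ) : ContDiff ℝ ∞ (planeWave k) := by
  unfold planeWave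
  refine Complex.contDiff_exp.comp (contDiff_const.mul ?_)
  exact Complex.ofRealCLM.contDiff.comp
    (ContDiff.sum fun i _ => contDiff_const.mul (contDiff_apply ℝ ℝ i))

theorem integrableOn_unitCube {E : Type*} [NormedAddCommGroup E] {u : (ι → ℝ) → E}
    (hu : Continuous u) : IntegrableOn u (unitCube ι) :=
  hu.continuousOn.integrableOn_compact isCompact_unitCube

/-- The Fourier coefficient of the restriction of `u` to the unit cube. -/
noncomputable def cubeCoeff (u : (ι → ℝ) → ℂ) (k : ι → ℤ) : ℂ :=
  ∫ x in unitCube ι, planeWave (-k) x * u x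

theorem norm_cubeCoeff_le (u : (ι → ℝ) → ℂ) (k : ι → ℤ) :
    ‖cubeCoeff u k‖ ≤ ∫ x in unitCube ι, ‖u x‖ := by
  refine (norm_integral_le_integral_norm _).trans (le_of_eq ?_)
  simp [norm_planeWave]

theorem mFourierCoeff_eq_cubeCoeff {u : (ι → ℝ) → ℂ} {F : C(UnitAddTorus ι, ℂ)}
    (hF : ∀ x ∈ unitCube ι, F (fun i => (x i : UnitAddCircle)) = u x) (k : ι → ℤ) :
    UnitAddTorus.mFourierCoeff F k = cubeCoeff u k := by
  rw [UnitAddTorus.mFourierCoeff_eq_integral F k (fun _ => -1 / 2), cubeCoeff]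
  have hset : {x : ι → ℝ | ∀ i, x i ∈ Set.Ioc (-1 / 2 : ℝ) (-1 / 2 + 1)}
      = Set.univ.pi fun _ => Set.Ioc (-1 / 2 : ℝ) (1 / 2) := by
    ext x; simp only [Set.mem_ofPred_eq, Set.mem_univ_pi]; norm_num
  have hae : (Set.univ.pi fun _ : ι => Set.Ioc (-1 / 2 : ℝ) (1 / 2)) =ᵐ[volume] unitCube ι := by
    rw [unitCube_eq_Icc]
    exact Measure.univ_pi_Ioc_ae_eq_Icc
  rw [hset, setIntegral_congr_set hae]
  refine setIntegral_congr_fun ?_ fun x hx => ?_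
  · rw [unitCube_eq_Icc]; exact measurableSet_Icc
  · simp only [mFourier_coe, hF x hx, smul_eq_mul]

variable [DecidableEq ι]

theorem planeWave_add_single (k : ι → ℤ) (x : ι → ℝ) (c : ι) :
    planeWave k (x + Pi.single c 1) = planeWave k x := by
  have h : (∑ i, (k i : ℝ) * (x + Pi.single c 1 : ι → ℝ) i) = (∑ i, (k i : ℝ) * x i) + k c := by
    simp [mul_add, Finset.sum_add_distrib, Pi.single_apply]
  rw [planeWave, h, Complex.ofReal_add, mul_add, Complex.exp_add]
  have : Complex.exp (2 * Real.pi * Complex.I * (((k c : ℤ) : ℝ) : ℂ)) = 1 := by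
    rw [← Complex.exp_int_mul_two_pi_mul_I (k c)]
    congr 1
    push_cast
    ring
  rw [this, mul_one, planeWave]

theorem dirDeriv_planeWave (k : ι → ℤ) (c : ι) (x : ι → ℝ) :
    dirDeriv (Pi.single c 1) (planeWave k) x = 2 * Real.pi * Complex.I * k c * planeWave k x := by
  have h0 : HasDerivAt (fun t : ℝ => planeWave k (x + t • Pi.single c 1))
      (2 * Real.pi * Complex.I * k c * planeWave k x) 0 := by
    have h (t : ℝ) : (∑ i, (k i : ℝ) * (x + t • Pi.single c 1 : ι → ℝ) i)
        = (∑ i, (k i : ℝ) * x i) + t * k c := by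
      simp [mul_add, Finset.sum_add_distrib, Pi.single_apply, mul_comm]
    simp only [planeWave, h]
    have h1 : HasDerivAt (fun t : ℝ => 2 * Real.pi * Complex.I *
        (((∑ i, (k i : ℝ) * x i) + t * k c : ℝ) : ℂ)) (2 * Real.pi * Complex.I * k c) 0 := by
      have h2 : HasDerivAt (fun t : ℝ => (∑ i, (k i : ℝ) * x i) + t * k c) (k c : ℝ) 0 := by
        simpa using ((hasDerivAt_id (0 : ℝ)).mul_const (k c : ℝ)).const_add
          (∑ i, (k i : ℝ) * x i)
      simpa using h2.ofReal_comp.const_mul (2 * Real.pi * Complex.I)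
    have h3 := h1.cexp
    simp only [zero_mul, add_zero] at h3
    convert! h3 using 1
    ring
  have hd : HasFDerivAt (planeWave k) (fderiv ℝ (planeWave k) x) x :=
    ((contDiff_planeWave k).differentiable (by simp) x).hasFDerivAt
  have hl : HasDerivAt (fun t : ℝ => x + t • (Pi.single c 1 : ι → ℝ)) (Pi.single c 1) 0 := by
    simpa using ((hasDerivAt_id (0 : ℝ)).smul_const (Pi.single c 1 : ι → ℝ)).const_add x
  have h1 := HasFDerivAt.comp_hasDerivAt (x := (0 : ℝ)) (f := fun t : ℝ => x + t • (Pi.single c 1 : ι → ℝ))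
    (l := planeWave k) (l' := fderiv ℝ (planeWave k) x) (by simpa using hd) hl
  exact h1.unique h0

/-- `u` takes equal values at the opposite points of the two faces of the unit cube orthogonal
to the coordinate direction `c`. -/
def FaceMatch (c : ι) (u : (ι → ℝ) → ℂ) : Prop :=
  ∀ X ∈ unitCube ι, X c = -1 / 2 → u X = u (X + Pi.single c 1)

/-- Integration by parts: there is no boundary term, because the boundary values match. -/
theorem cubeCoeff_dirDeriv {u : (ι → ℝ) → ℂ} (hu : ContDiff ℝ ∞ u) {c : ι} (hm : FaceMatch c u)
    (k : ι → ℤ) :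
    cubeCoeff (dirDeriv (Pi.single c 1) u) k = 2 * Real.pi * Complex.I * k c * cubeCoeff u k := by
  have hw := contDiff_planeWave (-k)
  have h0 := integral_dirDeriv_unitCube_eq_zero (u := fun x => planeWave (-k) x * u x)
    ((hw.mul hu).of_le (by simp)) c
    (fun X hX hXc => by simp only [planeWave_add_single, hm X hX hXc])
  have h1 : ∀ x, dirDeriv (Pi.single c 1) (fun x => planeWave (-k) x * u x) x =
      planeWave (-k) x * dirDeriv (Pi.single c 1) u x
        - 2 * Real.pi * Complex.I * k c * (planeWave (-k) x * u x) := by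
    intro x
    have := dirDeriv_planeWave (-k) c x
    simp only [dirDeriv] at this ⊢
    rw [fderiv_fun_mul (hw.differentiable (by simp) x) (hu.differentiable (by simp) x)]
    simp only [add_apply, smul_apply, smul_eq_mul, this, Pi.neg_apply,
      Int.cast_neg]
    ring
  simp only [h1] at h0
  rw [integral_sub, integral_const_mul] at h0
  · exact sub_eq_zero.1 h0
  · exact integrableOn_unitCube (hw.continuous.mul (contDiff_dirDeriv _ hu).continuous)
  · exact integrableOn_unitCube (continuous_const.mul (hw.continuous.mul hu.continuous))

theorem cubeCoeff_iterate_dirDeriv {u : (ι → ℝ) → ℂ} (hu : ContDiff ℝ ∞ u) {c : ι}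
    (hm : ∀ j, FaceMatch c ((dirDeriv (Pi.single c 1))^[j] u)) (k : ι → ℤ) (N : ℕ) :
    cubeCoeff ((dirDeriv (Pi.single c 1))^[N] u) k
      = (2 * Real.pi * Complex.I * k c) ^ N * cubeCoeff u k := by
  induction N with
  | zero => simp
  | succ N ih =>
    rw [Function.iterate_succ_apply',
      cubeCoeff_dirDeriv (contDiff_iterate_dirDeriv _ hu N) (hm N), ih]
    ring

/-- Decay of the Fourier coefficients: `N`-fold integration by parts in a direction `c` for which
`|k c|` is largest. -/
theorem norm_pow_mul_norm_cubeCoeff_le {u : (ι → ℝ) → ℂ} (hu : ContDiff ℝ ∞ u)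
    (hm : ∀ c j, FaceMatch c ((dirDeriv (Pi.single c 1))^[j] u)) (k : ι → ℤ) (N : ℕ) (hk : k ≠ 0) :
    ‖k‖ ^ N * ‖cubeCoeff u k‖
      ≤ ∑ c, ∫ x in unitCube ι, ‖(dirDeriv (Pi.single c 1))^[N] u x‖ := by
  obtain ⟨c₀, -⟩ := Function.ne_iff.1 hk
  obtain ⟨c, -, hc⟩ := Finset.exists_max_image Finset.univ (fun c => ‖k c‖) ⟨c₀, Finset.mem_univ _⟩
  have hkc : ‖k‖ ≤ ‖k c‖ :=
    (pi_norm_le_iff_of_nonneg (norm_nonneg _)).2 fun i => hc i (Finset.mem_univ _)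
  have h1 := norm_cubeCoeff_le ((dirDeriv (Pi.single c 1))^[N] u) k
  rw [cubeCoeff_iterate_dirDeriv hu (hm c), norm_mul, norm_pow] at h1
  have h2 : ‖k c‖ ≤ ‖(2 * Real.pi * Complex.I * k c : ℂ)‖ := by
    simp only [norm_mul, Complex.norm_I, Complex.norm_real, Complex.norm_ofNat, Complex.norm_intCast,
      Int.norm_eq_abs, Real.norm_eq_abs, abs_of_pos Real.pi_pos, mul_one]
    nlinarith [Real.pi_gt_three, abs_nonneg (k c : ℝ)]
  calc ‖k‖ ^ N * ‖cubeCoeff u k‖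
      ≤ ‖(2 * Real.pi * Complex.I * k c : ℂ)‖ ^ N * ‖cubeCoeff u k‖ := by
        gcongr; exact hkc.trans h2
    _ ≤ ∫ x in unitCube ι, ‖(dirDeriv (Pi.single c 1))^[N] u x‖ := h1
    _ ≤ _ := Finset.single_le_sum
        (f := fun c => ∫ x in unitCube ι, ‖(dirDeriv (Pi.single c 1))^[N] u x‖)
        (fun _ _ => integral_nonneg fun _ => norm_nonneg _) (Finset.mem_univ c)

/-! ### Descent to the torus -/

/-- The coordinates in `S` that equal `1/2` are replaced by `-1/2`. -/
noncomputable def lowerFace (S : Finset ι) (x : ι → ℝ) : ι → ℝ :=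
  fun i => if i ∈ S ∧ x i = 1 / 2 then -1 / 2 else x i

omit [Fintype ι] in
theorem lowerFace_mem (S : Finset ι) {x : ι → ℝ} (hx : x ∈ unitCube ι) :
    lowerFace S x ∈ unitCube ι := by
  intro i
  unfold lowerFace
  split_ifs
  · constructor <;> norm_num
  · exact hx i

omit [Fintype ι] in
theorem apply_lowerFace {u : (ι → ℝ) → ℂ} (hm : ∀ c, FaceMatch c u) (S : Finset ι) {x : ι → ℝ}
    (hx : x ∈ unitCube ι) : u (lowerFace S x) = u x := by
  induction S using Finset.induction_on with
  | empty =>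
    have h : lowerFace ∅ x = x := by funext i; simp [lowerFace]
    rw [h]
  | insert c S hc ih =>
    rw [← ih]
    by_cases hxc : x c = 1 / 2
    · have h1 : lowerFace S x = lowerFace (insert c S) x + Pi.single c 1 := by
        funext i
        rw [Pi.add_apply]
        by_cases hi : i = c
        · subst hi; simp only [lowerFace, hc, false_and, if_false, Finset.mem_insert, true_or, hxc,
            and_self, if_true, Pi.single_eq_same]; norm_num
        · simp [lowerFace, hi]
      rw [h1]
      exact hm c _ (lowerFace_mem _ hx) (by simp [lowerFace, hxc])
    · congr 1
      funext i
      by_cases hi : i = c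
      · subst hi; simp only [lowerFace, hxc, and_false]
      · simp [lowerFace, hi]

/-- The cube is compact, so the torus carries the quotient topology, and a function with matching
values on opposite faces descends to a continuous function. -/
theorem exists_torus_lift {u : (ι → ℝ) → ℂ} (hu : Continuous u) (hm : ∀ c, FaceMatch c u) :
    ∃ F : C(UnitAddTorus ι, ℂ), ∀ x ∈ unitCube ι, F (fun i => (x i : UnitAddCircle)) = u x := by
  let π : unitCube ι → UnitAddTorus ι := fun x i => ((x.1 i : ℝ) : UnitAddCircle)
  have hπc : Continuous π := by
    refine continuous_pi fun i => ?_
    exact (AddCircle.continuous_mk' 1).comp ((continuous_apply i).comp continuous_subtype_val)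
  have hπs : Function.Surjective π := by
    intro t
    have : ∀ i, ∃ y ∈ Set.Ico (-1 / 2 : ℝ) (-1 / 2 + 1), ((y : ℝ) : UnitAddCircle) = t i := by
      intro i
      have := AddCircle.coe_image_Ico_eq (1 : ℝ) (-1 / 2)
      have h2 : t i ∈ (Set.univ : Set (AddCircle (1 : ℝ))) := Set.mem_univ _
      rw [← this] at h2
      exact h2
    choose y hy hyt using this
    exact ⟨⟨y, fun i => ⟨(hy i).1, by linarith [(hy i).2]⟩⟩, funext hyt⟩
  have hinj : ∀ x y : unitCube ι, π x = π y → u x = u y := by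
    intro x y hxy
    rw [← apply_lowerFace hm Finset.univ x.2, ← apply_lowerFace hm Finset.univ y.2]
    congr 1
    have hIco : ∀ z : unitCube ι, ∀ i,
        lowerFace Finset.univ z.1 i ∈ Set.Ico (-1 / 2 : ℝ) (-1 / 2 + 1) := by
      intro z i
      have h := z.2 i
      simp only [lowerFace, Finset.mem_univ, true_and]
      split_ifs with h2
      · constructor <;> norm_num
      · refine ⟨h.1, ?_⟩
        have := lt_of_le_of_ne h.2 h2
        linarith
    have hcoe : ∀ z : unitCube ι, ∀ i,
        ((lowerFace Finset.univ z.1 i : ℝ) : UnitAddCircle) = (z.1 i : ℝ) := by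
      intro z i
      simp only [lowerFace, Finset.mem_univ, true_and]
      split_ifs with h2
      · rw [h2, ← AddCircle.coe_add_period (1 : ℝ) (-1 / 2)]; norm_num
      · rfl
    funext i
    have := congrFun hxy i
    simp only [π] at this
    rw [← hcoe x i, ← hcoe y i] at this
    exact (AddCircle.coe_eq_coe_iff_of_mem_Ico (hIco x i) (hIco y i)).1 this
  have : CompactSpace (unitCube ι) := isCompact_iff_compactSpace.1 isCompact_unitCube
  have hq := hπc.isClosedMap.isQuotientMap hπc hπs
  let F : UnitAddTorus ι → ℂ := fun t => u (Function.surjInv hπs t).1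
  have hF : ∀ x, F (π x) = u x := fun x => hinj _ _ (Function.surjInv_eq hπs (π x))
  refine ⟨⟨F, hq.continuous_iff.2 ?_⟩, fun x hx => hF ⟨x, hx⟩⟩
  have : F ∘ π = fun x => u x.1 := funext hF
  rw [this]
  exact hu.comp continuous_subtype_val

/-! ### Summability over the integer lattice and aliasing -/

omit [DecidableEq ι] in
/-- The term `k = 0` has the value `0⁻¹ = 0`. -/
theorem summable_norm_pow_inv_int {N : ℕ} (hN : Fintype.card ι < N) :
    Summable fun k : ι → ℤ => (‖k‖ ^ N)⁻¹ := by
  let b := Pi.basisFun ℝ ι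
  let L : Submodule ℤ (ι → ℝ) := Submodule.span ℤ (Set.range b)
  have hrank : Module.finrank ℤ L = Fintype.card ι := by
    rw [ZLattice.rank ℝ L]; simp
  have h := ZLattice.summable_norm_rpow L (-(N : ℝ)) (by rw [hrank]; simpa using hN)
  have hmem : ∀ k : ι → ℤ, (fun i => (k i : ℝ)) ∈ L := by
    intro k
    rw [Module.Basis.mem_span_iff_repr_mem]
    intro i
    exact ⟨k i, by simp [b]⟩
  let φ : (ι → ℤ) → L := fun k => ⟨fun i => (k i : ℝ), hmem k⟩
  have hφ : Function.Injective φ := by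
    intro k l h
    funext i
    have := congrFun (congrArg Subtype.val h) i
    simpa [φ] using this
  refine (h.comp_injective hφ).congr fun k => ?_
  have : ‖φ k‖ = ‖k‖ := by
    simp only [φ, Submodule.coe_norm, Pi.norm_def]
    congr 2
  simp only [Function.comp, this]
  rw [Real.rpow_neg (norm_nonneg _), Real.rpow_natCast]

/-- The node with index `j` of the uniform mesh with `m ^ card ι` points in the unit cube with
relative offset `x`. -/
noncomputable def cubeNode {m : ℕ} (x : ι → ℝ) (j : ι → Fin m) : ι → ℝ :=
  fun i => -1 / 2 + (((j i : ℕ) : ℝ) + x i) / (m : ℝ)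

omit [Fintype ι] [DecidableEq ι] in
theorem cubeNode_mem {m : ℕ} {x : ι → ℝ} (hx : ∀ i, x i ∈ Set.Icc (0 : ℝ) 1) (j : ι → Fin m) :
    cubeNode x j ∈ unitCube ι := by
  intro i
  have hm : (0 : ℝ) < m := by exact_mod_cast (j i).pos
  have hj : ((j i : ℕ) : ℝ) + 1 ≤ m := by exact_mod_cast (j i).2
  obtain ⟨h0, h1⟩ := hx i
  have hj0 : (0 : ℝ) ≤ ((j i : ℕ) : ℝ) := by positivity
  have h2 : 0 ≤ (((j i : ℕ) : ℝ) + x i) / (m : ℝ) := by positivity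
  have h3 : (((j i : ℕ) : ℝ) + x i) / (m : ℝ) ≤ 1 := by rw [div_le_one hm]; linarith
  constructor <;> simp only [cubeNode] <;> linarith

/-- The average of `u` over the mesh. -/
noncomputable def meshAverage (m : ℕ) (x : ι → ℝ) (u : (ι → ℝ) → ℂ) : ℂ :=
  (∑ j : ι → Fin m, u (cubeNode x j)) / (m : ℂ) ^ Fintype.card ι

theorem norm_meshAverage_planeWave_le {m : ℕ} (hm : 0 < m) (x : ι → ℝ) (k : ι → ℤ) :
    ‖meshAverage m x (planeWave k)‖ ≤ 1 := by
  have hm' : (0 : ℝ) < (m : ℝ) ^ Fintype.card ι := by positivity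
  rw [meshAverage, norm_div, norm_pow, Complex.norm_natCast, div_le_one hm']
  refine (norm_sum_le _ _).trans ?_
  simp [norm_planeWave]

theorem meshAverage_planeWave_zero {m : ℕ} (hm : 0 < m) (x : ι → ℝ) :
    meshAverage m x (planeWave 0) = 1 := by
  have hm' : (m : ℂ) ≠ 0 := by exact_mod_cast hm.ne'
  simp [meshAverage, planeWave, hm']

/-- A plane wave averages to zero unless all its frequencies are multiples of `m`. -/
theorem meshAverage_planeWave_eq_zero {m : ℕ} (hm : 0 < m) (x : ι → ℝ) {k : ι → ℤ} {i : ι}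
    (hk : ¬ (m : ℤ) ∣ k i) : meshAverage m x (planeWave k) = 0 := by
  have hm' : (m : ℂ) ≠ 0 := by exact_mod_cast hm.ne'
  have h1 : ∑ j : ι → Fin m, planeWave k (cubeNode x j) = ∏ i, ∑ a : Fin m,
      Complex.exp (2 * Real.pi * Complex.I * k i * ((-1 / 2 + ((a : ℕ) + x i) / m : ℝ) : ℂ)) := by
    rw [Finset.prod_univ_sum, Fintype.piFinset_univ]
    exact Finset.sum_congr rfl fun j _ => planeWave_eq_prod _ _
  rw [meshAverage, h1, Finset.prod_eq_zero (Finset.mem_univ i), zero_div]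
  let ζ : ℂ := Complex.exp (2 * Real.pi * Complex.I * k i / m)
  have hζm : ζ ^ m = 1 := by
    rw [← Complex.exp_nat_mul, ← Complex.exp_int_mul_two_pi_mul_I (k i)]
    congr 1
    field_simp
  have hζ1 : ζ ≠ 1 := by
    intro h
    obtain ⟨l, hl⟩ := Complex.exp_eq_one_iff.1 h
    refine hk ⟨l, ?_⟩
    have hpi : (2 * Real.pi * Complex.I : ℂ) ≠ 0 := Complex.two_pi_I_ne_zero
    have h3 : (2 * Real.pi * Complex.I : ℂ) * k i = (2 * Real.pi * Complex.I : ℂ) * (m * l) := by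
      field_simp at hl
      linear_combination (2 * Real.pi * Complex.I : ℂ) * hl
    exact_mod_cast mul_left_cancel₀ hpi h3
  have h2 : ∀ a : Fin m,
      Complex.exp (2 * Real.pi * Complex.I * k i * ((-1 / 2 + ((a : ℕ) + x i) / m : ℝ) : ℂ))
      = Complex.exp (2 * Real.pi * Complex.I * k i * (-1 / 2 + x i / m)) * ζ ^ (a : ℕ) := by
    intro a
    rw [← Complex.exp_nat_mul, ← Complex.exp_add]
    congr 1
    push_cast
    field_simp
    ring
  simp only [h2]
  rw [← Finset.mul_sum, Fin.sum_univ_eq_sum_range (fun a => ζ ^ a), geom_sum_eq hζ1, hζm]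
  simp

/-- Error of the trapezoidal rule on a cube for smooth functions with periodic boundary values:
expanding in a Fourier series, only the frequencies that are nonzero multiples of `m` contribute,
and those Fourier coefficients are bounded by means of pure derivatives of order `N`. -/
theorem exists_trapezoid_error_le {N : ℕ} (hN : Fintype.card ι < N) :
    ∃ C : ℝ, 0 ≤ C ∧ ∀ u : (ι → ℝ) → ℂ, ContDiff ℝ ∞ u →
      (∀ c j, FaceMatch c ((dirDeriv (Pi.single c 1))^[j] u)) →
      ∀ m : ℕ, 0 < m → ∀ x : ι → ℝ, (∀ i, x i ∈ Set.Icc (0 : ℝ) 1) →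
        ‖(∫ X in unitCube ι, u X) - meshAverage m x u‖
          ≤ C * ((m : ℝ) ^ N)⁻¹
            * ∑ c, ∫ X in unitCube ι, ‖(dirDeriv (Pi.single c 1))^[N] u X‖ := by
  have hsum := summable_norm_pow_inv_int (ι := ι) hN
  refine ⟨∑' k : ι → ℤ, (‖k‖ ^ N)⁻¹, tsum_nonneg fun k => by positivity, ?_⟩
  intro u hu hmatch m hm x hx
  set A := ∑ c, ∫ X in unitCube ι, ‖(dirDeriv (Pi.single c 1))^[N] u X‖ with hA
  have hA0 : 0 ≤ A :=
    Finset.sum_nonneg fun c _ => integral_nonneg fun _ => norm_nonneg _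
  have hmR : (0 : ℝ) < m := by exact_mod_cast hm
  have hcoef : ∀ k : ι → ℤ, k ≠ 0 → ‖cubeCoeff u k‖ ≤ A * (‖k‖ ^ N)⁻¹ := by
    intro k hk
    have h0 : 0 < ‖k‖ ^ N := pow_pos (norm_pos_iff.2 hk) N
    have := norm_pow_mul_norm_cubeCoeff_le hu hmatch k N hk
    rw [← div_eq_mul_inv, le_div_iff₀ h0, mul_comm]
    exact this
  obtain ⟨F, hF⟩ := exists_torus_lift hu.continuous (fun c => hmatch c 0)
  have hFs : Summable (UnitAddTorus.mFourierCoeff F) := by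
    refine Summable.of_norm_bounded_eventually (hsum.mul_left A) ?_
    filter_upwards [(Set.finite_singleton (0 : ι → ℤ)).compl_mem_cofinite] with k hk
    rw [mFourierCoeff_eq_cubeCoeff hF]
    exact hcoef k hk
  have hnode : ∀ j : ι → Fin m, HasSum (fun k => cubeCoeff u k * planeWave k (cubeNode x j))
      (u (cubeNode x j)) := by
    intro j
    have h1 := UnitAddTorus.hasSum_mFourier_series_apply_of_summable hFs
      (fun i => (cubeNode x j i : UnitAddCircle))
    rw [hF _ (cubeNode_mem hx j)] at h1
    simpa only [mFourierCoeff_eq_cubeCoeff hF, mFourier_coe, smul_eq_mul] using h1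
  have hav : HasSum (fun k => cubeCoeff u k * meshAverage m x (planeWave k)) (meshAverage m x u) := by
    have h1 := (hasSum_sum (s := Finset.univ) fun j _ => hnode j).div_const
      ((m : ℂ) ^ Fintype.card ι)
    refine h1.congr_fun fun k => ?_
    rw [meshAverage, ← Finset.mul_sum, mul_div_assoc]
  have hinj : Function.Injective fun l : ι → ℤ => (m : ℤ) • l := by
    intro l l' h
    funext i
    have := congrFun h i
    simpa [hm.ne'] using this
  have hav' := (hinj.hasSum_iff (f := fun k => cubeCoeff u k * meshAverage m x (planeWave k))
    (a := meshAverage m x u) (fun k hk => by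
      have : ∃ i, ¬ (m : ℤ) ∣ k i := by
        by_contra! h
        choose l hl using h
        exact hk ⟨l, funext fun i => by simp [hl i]⟩
      obtain ⟨i, hi⟩ := this
      rw [meshAverage_planeWave_eq_zero hm x hi, mul_zero])).2 hav
  -- Subtracting the frequency `0` removes the exact integral.
  have hdiff := hav'.sub (hasSum_ite_eq (0 : ι → ℤ) (cubeCoeff u 0))
  have h0 : cubeCoeff u 0 = ∫ X in unitCube ι, u X := by
    simp [cubeCoeff, planeWave]
  rw [← norm_neg, neg_sub, ← h0, ← hdiff.tsum_eq]
  have hb := hsum.hasSum.mul_left (((m : ℝ) ^ N)⁻¹ * A)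
  refine (tsum_of_norm_bounded hb fun l => ?_).trans (le_of_eq (by ring))
  by_cases hl : l = 0
  · subst hl
    simp only [Function.comp, smul_zero, meshAverage_planeWave_zero hm, mul_one, if_true, sub_self,
      norm_zero]
    positivity
  · have hml : (m : ℤ) • l ≠ 0 := by
      intro h; exact hl (hinj (by simpa using h))
    have hnorm : ‖(m : ℤ) • l‖ = m * ‖l‖ := by
      rw [norm_smul]; simp
    simp only [Function.comp, hl, if_false, sub_zero, norm_mul]
    calc ‖cubeCoeff u ((m : ℤ) • l)‖ * ‖meshAverage m x (planeWave ((m : ℤ) • l))‖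
        ≤ (A * (‖(m : ℤ) • l‖ ^ N)⁻¹) * 1 := by
          gcongr
          · exact hcoef _ hml
          · exact norm_meshAverage_planeWave_le hm x _
      _ = _ := by rw [hnorm, mul_pow, mul_inv]; ring

end fourier

/-! ### The trapezoidal rule for smooth periodic functions of several points -/

section points

variable {n d : ℕ}

/-- Currying, from flat coordinate vectors to tuples of points. -/
noncomputable def curryPts (n d : ℕ) : (Fin n × Fin d → ℝ) ≃L[ℝ] Pts n d :=
  (LinearEquiv.curry ℝ ℝ (Fin n) (Fin d)).toContinuousLinearEquiv

@[simp] theorem curryPts_apply (x : Fin n × Fin d → ℝ) (i : Fin n) (k : Fin d) :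
    curryPts n d x i k = x (i, k) := rfl

theorem unitVec_apply (c : Fin n × Fin d) (i : Fin n) (k : Fin d) :
    (unitVec c : Pts n d) i k = if (i, k) = c then 1 else 0 := by
  obtain ⟨i', k'⟩ := c
  unfold unitVec
  by_cases hi : i = i'
  · subst hi
    by_cases hk : k = k'
    · subst hk; simp
    · simp [hk]
  · simp [hi]

theorem curryPts_single (c : Fin n × Fin d) : curryPts n d (Pi.single c 1) = unitVec c := by
  funext i k
  rw [curryPts_apply, unitVec_apply, Pi.single_apply]

theorem curryPts_preimage_cubeV : curryPts n d ⁻¹' cubeV n d = unitCube (Fin n × Fin d) := by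
  ext x
  exact ⟨fun h c => h c.1 c.2, fun h i k => h (i, k)⟩

theorem curryPts_mem {x : Fin n × Fin d → ℝ} :
    curryPts n d x ∈ cubeV n d ↔ x ∈ unitCube (Fin n × Fin d) := by
  rw [← curryPts_preimage_cubeV]; rfl

theorem measurePreserving_curryPts : MeasurePreserving (curryPts n d) volume volume := by
  let e : (Fin n × Fin d → ℝ) ≃ᵐ Pts n d := (curryPts n d).toHomeomorph.toMeasurableEquiv
  suffices h : MeasurePreserving e.symm volume volume by exact h.symm e.symm
  refine ⟨e.symm.measurable, ?_⟩
  rw [volume_pi (ι := Fin n × Fin d)]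
  symm
  refine Measure.pi_eq fun s hs => ?_
  rw [e.symm.map_apply]
  have : e.symm ⁻¹' Set.univ.pi s = Set.univ.pi fun i => Set.univ.pi fun k => s (i, k) := by
    ext X
    simp only [Set.mem_preimage, Set.mem_univ_pi]
    exact ⟨fun h i k => h (i, k), fun h c => h c.1 c.2⟩
  rw [this, volume_pi_pi, Fintype.prod_prod_type]
  exact Finset.prod_congr rfl fun i _ => volume_pi_pi _

theorem setIntegral_cubeV_eq {E : Type*} [NormedAddCommGroup E] [NormedSpace ℝ E]
    (u : Pts n d → E) :
    ∫ X in cubeV n d, u X = ∫ x in unitCube (Fin n × Fin d), u (curryPts n d x) := by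
  rw [← curryPts_preimage_cubeV, measurePreserving_curryPts.setIntegral_preimage_emb
    (curryPts n d).toHomeomorph.measurableEmbedding]

theorem isCompact_cubeV : IsCompact (cubeV n d) := by
  have : cubeV n d = curryPts n d '' unitCube (Fin n × Fin d) := by
    rw [← curryPts_preimage_cubeV, Set.image_preimage_eq _ (curryPts n d).surjective]
  rw [this]
  exact isCompact_unitCube.image (curryPts n d).continuous

theorem measurableSet_cubeV : MeasurableSet (cubeV n d) := isCompact_cubeV.measurableSet

/-- `u` takes equal values at the opposite points of the two faces of `V^{×n}` orthogonal to the
coordinate direction `c`. -/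
def PtsFaceMatch {E : Type*} (c : Fin n × Fin d) (u : Pts n d → E) : Prop :=
  ∀ X ∈ cubeV n d, X c.1 c.2 = -1 / 2 → u X = u (X + unitVec c)

theorem integral_dirDeriv_cubeV_eq_zero {E : Type*} [NormedAddCommGroup E] [NormedSpace ℝ E]
    {u : Pts n d → E} (hu : ContDiff ℝ ∞ u) {c : Fin n × Fin d} (hm : PtsFaceMatch c u) :
    ∫ X in cubeV n d, dirDeriv (unitVec c) u X = 0 := by
  rw [setIntegral_cubeV_eq]
  have h := integral_dirDeriv_unitCube_eq_zero (u := u ∘ curryPts n d)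
    ((hu.of_le (by simp)).comp (curryPts n d).contDiff) c (fun x hx hxc => by
      simp only [Function.comp, map_add, curryPts_single]
      exact hm _ (curryPts_mem.2 hx) hxc)
  rw [dirDeriv_comp_equiv, curryPts_single] at h
  exact h

variable {𝕜 : Type*} [RCLike 𝕜]

theorem norm_rclikeMap (z : 𝕜) : ‖RCLike.map 𝕜 ℂ z‖ = ‖z‖ := by
  rw [← sq_eq_sq₀ (norm_nonneg _) (norm_nonneg _), ← RCLike.normSq_eq_def', ← RCLike.normSq_eq_def',
    RCLike.normSq_apply, RCLike.normSq_apply]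
  simp

theorem rclikeMap_trapezoidalRule (m : ℕ) (x : Pts n d) (u : Pts n d → 𝕜) :
    RCLike.map 𝕜 ℂ (trapezoidalRule m x u)
      = meshAverage m (fun c : Fin n × Fin d => x c.1 c.2)
          (fun y => RCLike.map 𝕜 ℂ (u (curryPts n d y))) := by
  have h1 : trapezoidalRule m x u
      = (((m : ℝ) ^ (n * d))⁻¹ : ℝ) • ∑ j : Fin n → Fin d → Fin m, u (meshNode x j) := by
    rw [trapezoidalRule, RCLike.real_smul_eq_coe_mul, div_eq_inv_mul]
    push_cast
    rfl
  rw [h1, map_smul, map_sum, meshAverage, Complex.real_smul, div_eq_inv_mul]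
  congr 1
  · simp
  · rw [← (Equiv.curry (Fin n) (Fin d) (Fin m)).sum_comp]
    rfl

/-- Error of the trapezoidal rule on `V^{×n}` for a smooth function with periodic boundary
values. -/
theorem exists_trapezoidalRule_error_le (𝕜 : Type*) [RCLike 𝕜] {N : ℕ} (hN : n * d < N) :
    ∃ C : ℝ, 0 ≤ C ∧ ∀ u : Pts n d → 𝕜, ContDiff ℝ ∞ u →
      (∀ c j, PtsFaceMatch c ((dirDeriv (unitVec c))^[j] u)) →
      ∀ m : ℕ, 0 < m → ∀ x : Pts n d, (∀ i k, x i k ∈ Set.Icc (0 : ℝ) 1) →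
        ‖(∫ X in cubeV n d, u X) - trapezoidalRule m x u‖
          ≤ C * ((m : ℝ) ^ N)⁻¹
            * ∑ c, ∫ X in cubeV n d, ‖(dirDeriv (unitVec c))^[N] u X‖ := by
  obtain ⟨C, hC, h⟩ := exists_trapezoid_error_le (ι := Fin n × Fin d) (N := N) (by simpa using hN)
  refine ⟨C, hC, fun u hu hmatch m hm x hx => ?_⟩
  let T := RCLike.map 𝕜 ℂ
  let L := curryPts n d
  have huL : ContDiff ℝ ∞ (u ∘ L) := hu.comp L.contDiff
  have hiter : ∀ c j, (dirDeriv (Pi.single c 1))^[j] (fun y => T ((u ∘ L) y))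
      = fun y => T ((dirDeriv (unitVec c))^[j] u (L y)) := by
    intro c j
    rw [iterate_dirDeriv_clm_comp T _ huL, iterate_dirDeriv_comp_equiv, curryPts_single]
    rfl
  have key := h (fun y => T ((u ∘ L) y)) (T.contDiff.comp huL) (fun c j => by
      rw [hiter]
      intro y hy hyc
      simp only [map_add]
      rw [show L (Pi.single c 1) = unitVec c from curryPts_single c,
        hmatch c j (L y) (curryPts_mem.2 hy) hyc]) m hm (fun c => x c.1 c.2) (fun c => hx _ _)
  have hint : ∫ y in unitCube (Fin n × Fin d), T ((u ∘ L) y) = T (∫ X in cubeV n d, u X) := by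
    rw [setIntegral_cubeV_eq]
    exact T.integral_comp_comm (integrableOn_unitCube huL.continuous)
  have htr := rclikeMap_trapezoidalRule m x u
  simp only [hiter] at key
  rw [hint, show (fun y => T ((u ∘ L) y)) = fun y => RCLike.map 𝕜 ℂ (u (curryPts n d y)) from rfl,
    ← htr, ← map_sub, norm_rclikeMap] at key
  refine key.trans (le_of_eq ?_)
  congr 1
  refine Finset.sum_congr rfl fun c _ => ?_
  rw [setIntegral_cubeV_eq]
  simp only [T, norm_rclikeMap]
  rfl

end points

/-! ### Iterated derivatives as repeated directional derivatives -/

section iterated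

variable {W E : Type*} [NormedAddCommGroup W] [NormedSpace ℝ W]
  [NormedAddCommGroup E] [NormedSpace ℝ E]

theorem contDiffAt_dirDeriv {u : W → E} {X : W} (hu : ContDiffAt ℝ ∞ u X) (v : W) :
    ContDiffAt ℝ ∞ (dirDeriv v u) X :=
  (hu.fderiv_right (m := ∞) (by simp)).clm_apply contDiffAt_const

theorem contDiffOn_dirDeriv {u : W → E} {s : Set W} (hs : IsOpen s) (hu : ContDiffOn ℝ ∞ u s)
    (v : W) : ContDiffOn ℝ ∞ (dirDeriv v u) s := fun _ hX =>
  (contDiffAt_dirDeriv (hu.contDiffAt (hs.mem_nhds hX)) v).contDiffWithinAt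

theorem iteratedFDeriv_succ_eq_dirDeriv {u : W → E} {X : W} (hu : ContDiffAt ℝ ∞ u X) {s : ℕ}
    (m : Fin (s + 1) → W) :
    iteratedFDeriv ℝ (s + 1) u X m
      = iteratedFDeriv ℝ s (dirDeriv (m (Fin.last s)) u) X (Fin.init m) := by
  rw [iteratedFDeriv_succ_apply_right]
  have h1 : ContDiffAt ℝ ∞ (fderiv ℝ u) X := hu.fderiv_right (m := ∞) (by simp)
  have := (ContinuousLinearMap.apply ℝ E (m (Fin.last s))).iteratedFDeriv_comp_left
    (i := s) (n := ∞) h1 (by exact_mod_cast le_top)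
  have h2 : dirDeriv (m (Fin.last s)) u
      = ContinuousLinearMap.apply ℝ E (m (Fin.last s)) ∘ fderiv ℝ u := rfl
  rw [h2, this]
  rfl

theorem dirDeriv_congr_on {u v : W → E} {s : Set W} (hs : IsOpen s) (h : Set.EqOn u v s) (w : W) :
    Set.EqOn (dirDeriv w u) (dirDeriv w v) s := fun X hX => by
  have : u =ᶠ[nhds X] v := h.eventuallyEq_of_mem (hs.mem_nhds hX)
  simp only [dirDeriv, this.fderiv_eq]

theorem dirDeriv_comm {u : W → E} {X : W} (hu : ContDiffAt ℝ ∞ u X) (v w : W) :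
    dirDeriv v (dirDeriv w u) X = dirDeriv w (dirDeriv v u) X := by
  have hsymm := hu.isSymmSndFDerivAt (by
    simp only [minSmoothness_of_isRCLikeNormedField]
    exact ENat.LEInfty.out)
  have h1 : DifferentiableAt ℝ (fderiv ℝ u) X :=
    (hu.fderiv_right (m := ∞) (by simp)).differentiableAt (by simp)
  have h2 : ∀ a b : W, dirDeriv a (dirDeriv b u) X = fderiv ℝ (fderiv ℝ u) X a b := by
    intro a b
    have : HasFDerivAt (dirDeriv b u)
        ((ContinuousLinearMap.apply ℝ E b).comp (fderiv ℝ (fderiv ℝ u) X)) X :=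
      (ContinuousLinearMap.apply ℝ E b).hasFDerivAt.comp X h1.hasFDerivAt
    rw [dirDeriv, this.fderiv]
    rfl
  rw [h2, h2, hsymm.eq]

/-- If an analytic function is `O(‖y‖ ^ a)`, its derivatives of order less than `a` vanish. -/
theorem iteratedFDeriv_eq_zero_of_isBigO [CompleteSpace E] {G : W → E} (hG : AnalyticAt ℝ G 0)
    {a : ℕ} (hO : G =O[nhds 0] fun y => ‖y‖ ^ a) {j : ℕ} (hj : j < a) :
    iteratedFDeriv ℝ j G 0 = 0 := by
  obtain ⟨p, r, hp⟩ := hG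
  have hdiag : ∀ j, j < a → ∀ y, (p j fun _ => y) = 0 := by
    intro j
    induction j using Nat.strong_induction_on with
    | _ j ih =>
      intro hj
      have hps : p.partialSum (j + 1) = fun y => p j fun _ => y := by
        funext y
        refine Finset.sum_eq_single _ (fun b hb hbj => ?_) fun h => ?_
        · have hb' := Finset.mem_range_succ_iff.1 hb
          exact ih b (hb'.lt_of_ne hbj) (by omega) y
        · exact absurd (Finset.mem_range.2 j.lt_succ_self) h
      have h1 := hp.hasFPowerSeriesAt.isBigO_sub_partialSum_pow (j + 1)
      simp only [hps, zero_add] at h1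
      have h2 : G =O[nhds 0] fun y => ‖y‖ ^ (j + 1) := by
        refine hO.trans (IsBigO.of_bound 1 ?_)
        filter_upwards [Metric.closedBall_mem_nhds (0 : W) one_pos] with y hy
        have hy1 : ‖y‖ ≤ 1 := by simpa using hy
        simp only [norm_pow, norm_norm, one_mul]
        exact pow_le_pow_of_le_one (norm_nonneg _) hy1 hj
      have h3 := h2.sub h1
      simp only [sub_sub_cancel] at h3
      exact fun y => h3.continuousMultilinearMap_apply_eq_zero y
  ext v
  rw [hp.iteratedFDeriv_eq_sum_of_completeSpace, ← (p j).iteratedFDeriv_comp_diagonal 0 v]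
  have : (fun x => p j fun _ => x) = fun _ => 0 := funext (hdiag j hj)
  rw [this]
  simp

end iterated

theorem mixedPartial_zero {𝕜 : Type*} [RCLike 𝕜] {n d : ℕ} (c : Fin 0 → Fin n × Fin d)
    (g : Pts n d → 𝕜) : mixedPartial c g = g := by
  funext X
  simp [mixedPartial]

theorem mixedPartial_succ {𝕜 : Type*} [RCLike 𝕜] {n d s : ℕ} (c : Fin (s + 1) → Fin n × Fin d)
    {g : Pts n d → 𝕜} {X : Pts n d} (hg : ContDiffAt ℝ ∞ g X) :
    mixedPartial c g X
      = mixedPartial (Fin.init c) (dirDeriv (unitVec (c (Fin.last s))) g) X := by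
  rw [mixedPartial, iteratedFDeriv_succ_eq_dirDeriv hg]
  rfl

theorem mixedPartial_succ_left {𝕜 : Type*} [RCLike 𝕜] {n d s : ℕ}
    (c : Fin (s + 1) → Fin n × Fin d) {g : Pts n d → 𝕜} (hg : ContDiff ℝ ∞ g) :
    mixedPartial c g = dirDeriv (unitVec (c 0)) (mixedPartial (Fin.tail c) g) := by
  funext X
  have h1 : DifferentiableAt ℝ (iteratedFDeriv ℝ s g) X :=
    (hg.differentiable_iteratedFDeriv (m := s) (by exact_mod_cast WithTop.coe_lt_top _)) X
  let T := ContinuousMultilinearMap.apply ℝ (fun _ : Fin s => Pts n d) 𝕜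
    (fun r => unitVec (Fin.tail c r))
  have h2 : HasFDerivAt (mixedPartial (Fin.tail c) g)
      (T.comp (fderiv ℝ (iteratedFDeriv ℝ s g) X)) X := T.hasFDerivAt.comp X h1.hasFDerivAt
  rw [dirDeriv, h2.fderiv, mixedPartial, iteratedFDeriv_succ_apply_left]
  rfl

theorem contDiff_mixedPartial {𝕜 : Type*} [RCLike 𝕜] {n d s : ℕ}
    (c : Fin s → Fin n × Fin d) {g : Pts n d → 𝕜} (hg : ContDiff ℝ ∞ g) :
    ContDiff ℝ ∞ (mixedPartial c g) := by
  induction s with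
  | zero => rw [mixedPartial_zero]; exact hg
  | succ s ih => rw [mixedPartial_succ_left c hg]; exact contDiff_dirDeriv _ (ih _)

theorem iterate_dirDeriv_eq_mixedPartial {𝕜 : Type*} [RCLike 𝕜] {n d : ℕ}
    (c : Fin n × Fin d) {g : Pts n d → 𝕜} (hg : ContDiff ℝ ∞ g) (j : ℕ) :
    (dirDeriv (unitVec c))^[j] g = mixedPartial (fun _ : Fin j => c) g := by
  induction j with
  | zero => rw [mixedPartial_zero]; rfl
  | succ j ih => rw [Function.iterate_succ_apply', ih, mixedPartial_succ_left _ hg]; rfl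

/-! ### Symbol estimates -/

section symbol

variable {𝕜 : Type*} [RCLike 𝕜] {n d : ℕ} {P : Type*}

/-- The points with all `xᵢ ≠ 0`. -/
def offSing (n d : ℕ) : Set (Pts n d) := {X | ∀ i, X i ≠ 0}

theorem isOpen_offSing : IsOpen (offSing n d) := by
  have : offSing n d = ⋂ i, {X | X i ≠ 0} := by ext X; simp [offSing]
  rw [this]
  exact isOpen_iInter_of_finite fun i => isOpen_ne_fun (continuous_apply i) continuous_const

/-- The weight `∏ᵢ ‖xᵢ‖ ^ eᵢ`. -/
noncomputable def blockWeight (e : Fin n → ℝ) (X : Pts n d) : ℝ := ∏ i, ‖X i‖ ^ e i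

theorem blockWeight_nonneg (e : Fin n → ℝ) (X : Pts n d) : 0 ≤ blockWeight e X :=
  Finset.prod_nonneg fun _ _ => Real.rpow_nonneg (norm_nonneg _) _

theorem blockWeight_add {e e' : Fin n → ℝ} {X : Pts n d} (hX : X ∈ offSing n d) :
    blockWeight (e + e') X = blockWeight e X * blockWeight e' X := by
  simp only [blockWeight, ← Finset.prod_mul_distrib]
  exact Finset.prod_congr rfl fun i _ => Real.rpow_add (norm_pos_iff.2 (hX i)) _ _

theorem blockWeight_single (i : Fin n) (t : ℝ) (X : Pts n d) :
    blockWeight (Pi.single i t) X = ‖X i‖ ^ t := by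
  rw [blockWeight, Finset.prod_eq_single i]
  · simp
  · intro j _ hj; simp [hj]
  · simp

theorem norm_block_le {X : Pts n d} (hX : X ∈ cubeV n d) (i : Fin n) : ‖X i‖ ≤ 1 := by
  refine (pi_norm_le_iff_of_nonneg zero_le_one).2 fun k => ?_
  rw [Real.norm_eq_abs, abs_le]
  have := hX i k
  constructor <;> linarith [this.1, this.2]

theorem blockWeight_anti {e e' : Fin n → ℝ} (h : e' ≤ e) {X : Pts n d} (hX : X ∈ offSing n d)
    (hV : X ∈ cubeV n d) : blockWeight e X ≤ blockWeight e' X :=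
  Finset.prod_le_prod (fun _ _ => Real.rpow_nonneg (norm_nonneg _) _) fun i _ =>
    Real.rpow_le_rpow_of_exponent_ge (norm_pos_iff.2 (hX i)) (norm_block_le hV i) (h i)

/-- The members of the family `u` are smooth off the singular set and bounded by
a common multiple of the weight with exponents `e` on `V^{×n}`. -/
def WeightBound (e : Fin n → ℝ) (u : P → Pts n d → 𝕜) : Prop :=
  (∀ p, ContDiffOn ℝ ∞ (u p) (offSing n d)) ∧
    ∃ C, 0 ≤ C ∧ ∀ p, ∀ X ∈ cubeV n d, X ∈ offSing n d → ‖u p X‖ ≤ C * blockWeight e X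

/-- The family `u` is a symbol with exponents `e` up to order `k`: it obeys the weight bound, and
so do its derivatives up to order `k`, where each derivative in a coordinate of `xᵢ` lowers the
exponent `eᵢ` by one. The bounds are uniform over the family. -/
def IsSymbol : ℕ → (Fin n → ℝ) → (P → Pts n d → 𝕜) → Prop
  | 0, e, u => WeightBound e u
  | k + 1, e, u => WeightBound e u ∧
      ∀ c : Fin n × Fin d, IsSymbol k (e - Pi.single c.1 1) fun p => dirDeriv (unitVec c) (u p)

namespace IsSymbol

variable {k : ℕ} {e e' : Fin n → ℝ} {u v : P → Pts n d → 𝕜}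

theorem weightBound (h : IsSymbol k e u) : WeightBound e u := by
  cases k with
  | zero => exact h
  | succ k => exact h.1

theorem contDiffOn (h : IsSymbol k e u) (p : P) : ContDiffOn ℝ ∞ (u p) (offSing n d) :=
  h.weightBound.1 p

theorem contDiffAt (h : IsSymbol k e u) (p : P) {X : Pts n d} (hX : X ∈ offSing n d) :
    ContDiffAt ℝ ∞ (u p) X :=
  (h.contDiffOn p).contDiffAt (isOpen_offSing.mem_nhds hX)

theorem congr (h : IsSymbol k e u) (huv : ∀ p, Set.EqOn (v p) (u p) (offSing n d)) :
    IsSymbol k e v := by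
  have hbase : ∀ {e : Fin n → ℝ} {u v : P → Pts n d → 𝕜}, WeightBound e u →
      (∀ p, Set.EqOn (v p) (u p) (offSing n d)) → WeightBound e v := by
    rintro e u v ⟨hs, C, hC, hb⟩ huv
    exact ⟨fun p => (hs p).congr (huv p), C, hC, fun p X hV hX => by
      rw [huv p hX]; exact hb p X hV hX⟩
  induction k generalizing e u v with
  | zero => exact hbase h huv
  | succ k ih =>
    exact ⟨hbase h.1 huv, fun c => ih (h.2 c)
      fun p => dirDeriv_congr_on isOpen_offSing (huv p) (unitVec c)⟩

theorem of_succ (h : IsSymbol (k + 1) e u) : IsSymbol k e u := by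
  induction k generalizing e u with
  | zero => exact h.1
  | succ k ih => exact ⟨h.1, fun c => ih (h.2 c)⟩

theorem mono (h : IsSymbol k e u) (he : e' ≤ e) : IsSymbol k e' u := by
  have hb : ∀ {e e' : Fin n → ℝ} {u : P → Pts n d → 𝕜}, e' ≤ e → WeightBound e u →
      WeightBound e' u := by
    rintro e e' u he ⟨hs, C, hC, hb⟩
    exact ⟨hs, C, hC, fun p X hV hX => (hb p X hV hX).trans
      (mul_le_mul_of_nonneg_left (blockWeight_anti he hX hV) hC)⟩
  induction k generalizing e e' u with
  | zero => exact hb he h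
  | succ k ih => exact ⟨hb he h.1, fun c => ih (h.2 c) (sub_le_sub_right he _)⟩

theorem add (hu : IsSymbol k e u) (hv : IsSymbol k e v) :
    IsSymbol k e fun p X => u p X + v p X := by
  induction k generalizing e u v with
  | zero =>
    obtain ⟨hs, C, hC, hb⟩ := hu
    obtain ⟨hs', C', hC', hb'⟩ := hv
    refine ⟨fun p => (hs p).add (hs' p), C + C', by positivity, fun p X hV hX => ?_⟩
    rw [add_mul]
    exact (norm_add_le _ _).trans (add_le_add (hb p X hV hX) (hb' p X hV hX))
  | succ k ih =>
    refine ⟨(ih hu.of_succ hv.of_succ).weightBound, fun c => ?_⟩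
    refine (ih (hu.2 c) (hv.2 c)).congr fun p X hX => ?_
    simp only [dirDeriv]
    rw [fderiv_fun_add ((hu.contDiffAt p hX).differentiableAt (by simp))
      ((hv.contDiffAt p hX).differentiableAt (by simp))]
    rfl

/-- The exponents of a product add up, by the product rule. -/
theorem mul (hu : IsSymbol k e u) (hv : IsSymbol k e' v) :
    IsSymbol k (e + e') fun p X => u p X * v p X := by
  induction k generalizing e e' u v with
  | zero =>
    obtain ⟨hs, C, hC, hb⟩ := hu
    obtain ⟨hs', C', hC', hb'⟩ := hv
    refine ⟨fun p => (hs p).mul (hs' p), C * C', by positivity, fun p X hV hX => ?_⟩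
    rw [blockWeight_add hX, mul_mul_mul_comm, norm_mul]
    exact mul_le_mul (hb p X hV hX) (hb' p X hV hX) (norm_nonneg _)
      (mul_nonneg hC (blockWeight_nonneg _ _))
  | succ k ih =>
    refine ⟨(ih hu.of_succ hv.of_succ).weightBound, fun c => ?_⟩
    have h1 := ih (hu.2 c) hv.of_succ
    have h2 := ih hu.of_succ (hv.2 c)
    rw [sub_add_eq_add_sub] at h1
    rw [← add_sub_assoc] at h2
    refine (h1.add h2).congr fun p X hX => ?_
    simp only [dirDeriv]
    rw [fderiv_fun_mul ((hu.contDiffAt p hX).differentiableAt (by simp))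
      ((hv.contDiffAt p hX).differentiableAt (by simp))]
    simp only [add_apply, smul_apply, smul_eq_mul]
    ring

theorem const (a : 𝕜) : IsSymbol k 0 fun (_ : P) (_ : Pts n d) => a := by
  have h0 : ∀ k (e : Fin n → ℝ), IsSymbol k e fun (_ : P) (_ : Pts n d) => (0 : 𝕜) := by
    intro k
    have hb : ∀ e : Fin n → ℝ, WeightBound e fun (_ : P) (_ : Pts n d) => (0 : 𝕜) := fun e =>
      ⟨fun _ => contDiffOn_const, 0, le_rfl, fun p X _ _ => by simp⟩
    induction k with
    | zero => exact hb
    | succ k ih =>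
      refine fun e => ⟨hb e, fun c => (ih _).congr fun p X _ => ?_⟩
      simp [dirDeriv]
  have hb : WeightBound 0 fun (_ : P) (_ : Pts n d) => a :=
    ⟨fun _ => contDiffOn_const, ‖a‖, norm_nonneg _, fun p X _ _ => by simp [blockWeight]⟩
  cases k with
  | zero => exact hb
  | succ k =>
    refine ⟨hb, fun c => (h0 k _).congr fun p X _ => ?_⟩
    simp [dirDeriv]

theorem prod {ι : Type*} (s : Finset ι) {E : ι → Fin n → ℝ} {U : ι → P → Pts n d → 𝕜}
    (h : ∀ i ∈ s, IsSymbol k (E i) (U i)) :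
    IsSymbol k (∑ i ∈ s, E i) fun p X => ∏ i ∈ s, U i p X := by
  classical
  induction s using Finset.induction_on with
  | empty => simpa using const (1 : 𝕜)
  | insert i s hi ih =>
    simp only [Finset.sum_insert hi, Finset.prod_insert hi]
    exact (h i (Finset.mem_insert_self i s)).mul
      (ih fun j hj => h j (Finset.mem_insert_of_mem hj))

theorem clm_comp {𝕜' : Type*} [RCLike 𝕜'] (L : 𝕜 →L[ℝ] 𝕜') (hu : IsSymbol k e u) :
    IsSymbol k e fun p X => L (u p X) := by
  induction k generalizing e u with
  | zero =>
    obtain ⟨hs, C, hC, hb⟩ := hu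
    refine ⟨fun p => L.contDiff.comp_contDiffOn (hs p), ‖L‖ * C, by positivity,
      fun p X hV hX => ?_⟩
    rw [mul_assoc]
    exact (L.le_opNorm _).trans (mul_le_mul_of_nonneg_left (hb p X hV hX) (norm_nonneg _))
  | succ k ih =>
    refine ⟨(ih hu.of_succ).weightBound, fun c => (ih (hu.2 c)).congr fun p X hX => ?_⟩
    exact dirDeriv_clm_comp L _ ((hu.contDiffAt p hX).differentiableAt (by simp))

/-- The symbol estimate for a mixed partial derivative. -/
theorem exists_mixedPartial_le {s : ℕ} (hu : IsSymbol s e u) (c : Fin s → Fin n × Fin d) :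
    ∃ C, 0 ≤ C ∧ ∀ p, ∀ X ∈ cubeV n d, X ∈ offSing n d →
      ‖mixedPartial c (u p) X‖ ≤ C * blockWeight (e - ∑ r, Pi.single (c r).1 1) X := by
  induction s generalizing e u with
  | zero =>
    obtain ⟨-, C, hC, hb⟩ := hu
    exact ⟨C, hC, fun p X hV hX => by simpa [mixedPartial_zero] using hb p X hV hX⟩
  | succ s ih =>
    obtain ⟨C, hC, hb⟩ := ih (hu.2 (c (Fin.last s))) (Fin.init c)
    refine ⟨C, hC, fun p X hV hX => ?_⟩
    have hsum : e - ∑ r, Pi.single (c r).1 1 = e - Pi.single (c (Fin.last s)).1 1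
        - ∑ r, Pi.single (Fin.init (α := fun _ => Fin n × Fin d) c r).1 1 := by
      rw [Fin.sum_univ_castSucc, sub_sub, add_comm]
      rfl
    rw [mixedPartial_succ c (hu.contDiffAt p hX), hsum]
    exact hb p X hV hX

end IsSymbol

end symbol

/-! ### Functions vanishing to a given order in one of the points -/

section vanish

variable {𝕜 : Type*} [RCLike 𝕜] {n d : ℕ} {P : Type*}

/-- All derivatives of `F` of order less than `a` in the coordinates of `xᵢ` vanish on
`{xᵢ = 0}`. -/
def VanishOrder (i : Fin n) : ℕ → (Pts n d → 𝕜) → Prop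
  | 0, _ => True
  | a + 1, F => (∀ X, X i = 0 → F X = 0) ∧
      ∀ k : Fin d, VanishOrder i a (dirDeriv (unitVec (i, k)) F)

theorem hasFDerivAt_comp_update {F : Pts n d → 𝕜} (hF : ContDiff ℝ ∞ F) (X : Pts n d) (i : Fin n)
    (y : Fin d → ℝ) :
    HasFDerivAt (fun y => F (Function.update X i y))
      ((fderiv ℝ F (Function.update X i y)).comp
        (ContinuousLinearMap.single ℝ (fun _ : Fin n => Fin d → ℝ) i)) y := by
  have h1 := hasFDerivAt_update (𝕜 := ℝ) X (i := i) y
  have h2 := (hF.differentiable (by simp) (Function.update X i y)).hasFDerivAt.comp y h1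
  convert! h2 using 2
  ext v j
  by_cases hj : j = i
  · subst hj; simp
  · simp [hj]

theorem dirDeriv_comp_update {F : Pts n d → 𝕜} (hF : ContDiff ℝ ∞ F) (X : Pts n d) (i : Fin n)
    (k : Fin d) :
    dirDeriv (Pi.single k 1) (fun y => F (Function.update X i y))
      = fun y => dirDeriv (unitVec (i, k)) F (Function.update X i y) := by
  funext y
  rw [dirDeriv, (hasFDerivAt_comp_update hF X i y).fderiv]
  rfl

theorem contDiff_comp_update {F : Pts n d → 𝕜} (hF : ContDiff ℝ ∞ F) (X : Pts n d) (i : Fin n) :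
    ContDiff ℝ ∞ fun y => F (Function.update X i y) :=
  hF.comp (contDiff_update ∞ X i)

theorem vanishOrder_of_iteratedFDeriv {F : Pts n d → 𝕜} (hF : ContDiff ℝ ∞ F) {i : Fin n} {a : ℕ}
    (h : ∀ X, ∀ j < a, iteratedFDeriv ℝ j (fun y => F (Function.update X i y)) 0 = 0) :
    VanishOrder i a F := by
  induction a generalizing F with
  | zero => trivial
  | succ a ih =>
    refine ⟨fun X hX => ?_, fun k => ih (contDiff_dirDeriv _ hF) fun X j hj => ?_⟩
    · have h0 := congrArg (fun L => L 0) (h X 0 a.succ_pos)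
      simp only [iteratedFDeriv_zero_apply] at h0
      rw [← hX, Function.update_eq_self] at h0
      exact h0
    · ext v
      have h1 := iteratedFDeriv_succ_eq_dirDeriv
        (contDiff_comp_update hF X i).contDiffAt (X := 0)
        (Fin.snoc (α := fun _ => Fin d → ℝ) v (Pi.single k 1))
      rw [h X (j + 1) (by omega), Fin.snoc_last, Fin.init_snoc, dirDeriv_comp_update hF] at h1
      exact h1.symm

theorem vanishOrder_of_isBigO {F : Pts n d → 𝕜} (hF : ContDiff ℝ ∞ F) {i : Fin n} {a : ℕ}
    (hA : ∀ X, AnalyticAt ℝ (fun y => F (Function.update X i y)) 0)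
    (hO : ∀ X, (fun y => F (Function.update X i y))
      =O[nhds 0] fun y : Fin d → ℝ => ‖WithLp.toLp 2 y‖ ^ a) :
    VanishOrder i a F := by
  refine vanishOrder_of_iteratedFDeriv hF fun X j hj =>
    iteratedFDeriv_eq_zero_of_isBigO (hA X) ((hO X).trans ?_) hj
  refine IsBigO.pow ?_ a
  exact ((EuclideanSpace.equiv (Fin d) ℝ).symm.toContinuousLinearMap.isBigO_id
    (nhds 0)).norm_norm

theorem VanishOrder.dirDeriv_of_ne {i : Fin n} {c : Fin n × Fin d} (hc : c.1 ≠ i) {a : ℕ}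
    {F : Pts n d → 𝕜} (hF : ContDiff ℝ ∞ F) (h : VanishOrder i a F) :
    VanishOrder i a (dirDeriv (unitVec c) F) := by
  induction a generalizing F with
  | zero => trivial
  | succ a ih =>
    refine ⟨fun X hX => ?_, fun k => ?_⟩
    · have hd := (hF.differentiable (by simp) X).hasFDerivAt
      have hl : HasDerivAt (fun t : ℝ => X + t • (unitVec c : Pts n d)) (unitVec c) 0 := by
        simpa using ((hasDerivAt_id (0 : ℝ)).smul_const (unitVec c : Pts n d)).const_add X
      have h1 := HasFDerivAt.comp_hasDerivAt (x := (0 : ℝ))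
        (f := fun t : ℝ => X + t • (unitVec c : Pts n d)) (l := F) (l' := fderiv ℝ F X)
        (by simpa using hd) hl
      have h2 : (F ∘ fun t : ℝ => X + t • (unitVec c : Pts n d)) = fun _ => 0 := by
        funext t
        refine h.1 _ ?_
        have : (unitVec c : Pts n d) i = 0 := by unfold unitVec; exact Pi.single_eq_of_ne hc.symm _
        simp [hX, this]
      rw [h2] at h1
      exact h1.unique (hasDerivAt_const _ _)
    · have : dirDeriv (unitVec (i, k)) (dirDeriv (unitVec c) F)
          = dirDeriv (unitVec c) (dirDeriv (unitVec (i, k)) F) :=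
        funext fun X => dirDeriv_comm hF.contDiffAt _ _
      rw [this]
      exact ih (contDiff_dirDeriv _ hF) (h.2 k)

theorem update_mem_cubeV {X : Pts n d} (hX : X ∈ cubeV n d) (i : Fin n) {t : ℝ}
    (ht : t ∈ Set.Icc (0 : ℝ) 1) : Function.update X i (t • X i) ∈ cubeV n d := by
  intro j k
  by_cases hj : j = i
  · subst hj
    have h := hX j k
    simp only [Function.update_self, Pi.smul_apply, smul_eq_mul]
    constructor <;> nlinarith [h.1, h.2, ht.1, ht.2]
  · simpa [hj] using hX j k

/-- Taylor's theorem in `xᵢ`, with a bound that is uniform in the other points. -/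
theorem VanishOrder.exists_norm_le {i : Fin n} {a : ℕ} {F : Pts n d → 𝕜} (hF : ContDiff ℝ ∞ F)
    (h : VanishOrder i a F) :
    ∃ C, 0 ≤ C ∧ ∀ X ∈ cubeV n d, ‖F X‖ ≤ C * ‖X i‖ ^ a := by
  induction a generalizing F with
  | zero =>
    obtain ⟨C, hC⟩ := isCompact_cubeV.exists_bound_of_continuousOn (s := cubeV n d)
      hF.continuous.continuousOn
    exact ⟨max C 0, le_max_right _ _, fun X hX => by
      simpa using Or.inl (hC X hX)⟩
  | succ a ih =>
    choose C hC hb using fun k => ih (contDiff_dirDeriv (unitVec (i, k)) hF) (h.2 k)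
    refine ⟨∑ k, C k, Finset.sum_nonneg fun k _ => hC k, fun X hX => ?_⟩
    -- The mean value inequality on the segment from the point with `xᵢ = 0` to `X`.
    let φ : ℝ → 𝕜 := fun t => F (Function.update X i (t • X i))
    have hφ : ∀ t, HasDerivAt φ
        (∑ k, X i k • dirDeriv (unitVec (i, k)) F (Function.update X i (t • X i))) t := by
      intro t
      have h1 := hasFDerivAt_comp_update hF X i (t • X i)
      have h2 : HasDerivAt (fun t : ℝ => t • X i) (X i) t := by
        simpa using (hasDerivAt_id t).smul_const (X i)
      have h3 := HasFDerivAt.comp_hasDerivAt t h1 h2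
      convert! h3 using 1
      have h4 : X i = ∑ k, X i k • (Pi.single k 1 : Fin d → ℝ) := by
        conv_lhs => rw [pi_eq_sum_univ' (X i)]
      conv_rhs => rw [h4]
      rw [map_sum]
      refine Finset.sum_congr rfl fun k _ => ?_
      rw [map_smul, ← h4]
      rfl
    have hbound : ∀ t ∈ Set.Ico (0 : ℝ) 1,
        ‖∑ k, X i k • dirDeriv (unitVec (i, k)) F (Function.update X i (t • X i))‖
          ≤ (∑ k, C k) * ‖X i‖ ^ (a + 1) := by
      intro t ht
      refine (norm_sum_le _ _).trans ?_
      rw [Finset.sum_mul]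
      refine Finset.sum_le_sum fun k _ => ?_
      rw [norm_smul]
      have h1 := hb k _ (update_mem_cubeV hX i ⟨ht.1, ht.2.le⟩)
      rw [Function.update_self, norm_smul, Real.norm_eq_abs, abs_of_nonneg ht.1] at h1
      have h2 : (t * ‖X i‖) ^ a ≤ ‖X i‖ ^ a := by
        refine pow_le_pow_left₀ (mul_nonneg ht.1 (norm_nonneg _)) ?_ a
        exact mul_le_of_le_one_left (norm_nonneg _) ht.2.le
      calc ‖X i k‖ * ‖dirDeriv (unitVec (i, k)) F (Function.update X i (t • X i))‖
          ≤ ‖X i‖ * (C k * ‖X i‖ ^ a) := by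
            refine mul_le_mul (norm_le_pi_norm (X i) k) (h1.trans ?_) (norm_nonneg _)
              (norm_nonneg _)
            exact mul_le_mul_of_nonneg_left h2 (hC k)
        _ = C k * ‖X i‖ ^ (a + 1) := by ring
    have := norm_image_sub_le_of_norm_deriv_le_segment_01'
      (fun t _ => (hφ t).hasDerivWithinAt) hbound
    have h0 : φ 0 = 0 := h.1 _ (by simp)
    have h1 : φ 1 = F X := by simp [φ]
    rwa [h0, h1, sub_zero] at this

/-- A derivative in a coordinate of `xᵢ` lowers the order of vanishing by one, any other derivative
keeps it; on `V^{×n}` lowering an exponent further only enlarges the weight. -/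
theorem VanishOrder.isSymbol {i : Fin n} {a : ℕ} {F : Pts n d → 𝕜} (hF : ContDiff ℝ ∞ F)
    (h : VanishOrder i a F) (k : ℕ) :
    IsSymbol k (Pi.single i (a : ℝ)) fun _ : P => F := by
  have hb : ∀ {a : ℕ} {F : Pts n d → 𝕜}, ContDiff ℝ ∞ F → VanishOrder i a F →
      WeightBound (Pi.single i (a : ℝ)) fun _ : P => F := by
    intro a F hF h
    obtain ⟨C, hC, hle⟩ := h.exists_norm_le hF
    refine ⟨fun _ => hF.contDiffOn, C, hC, fun _ X hV _ => ?_⟩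
    rw [blockWeight_single, Real.rpow_natCast]
    exact hle X hV
  have hsingle : ∀ j : Fin n, (0 : Fin n → ℝ) ≤ Pi.single j 1 := fun j =>
    Pi.single_nonneg.2 zero_le_one
  induction k generalizing a F with
  | zero => exact hb hF h
  | succ k ih =>
    refine ⟨hb hF h, fun c => ?_⟩
    have hF' := contDiff_dirDeriv (unitVec c) hF
    by_cases hc : c.1 = i
    · obtain ⟨i', l⟩ := c
      obtain rfl : i' = i := hc
      cases a with
      | zero =>
        refine (ih (a := 0) hF' trivial).mono ?_
        simp
      | succ a =>
        have : (Pi.single i' ((a + 1 : ℕ) : ℝ) - Pi.single i' 1 : Fin n → ℝ)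
            = Pi.single i' (a : ℝ) := by
          rw [← Pi.single_sub]; simp
        simp only [this]
        exact ih hF' (h.2 l)
    · exact (ih hF' (h.dirDeriv_of_ne hc hF)).mono (sub_le_self _ (hsingle _))

end vanish

/-! ### Powers of the quadratic form -/

section quadratic

variable {𝕜 : Type*} [RCLike 𝕜] {n d : ℕ} {P : Type*} {M : Matrix (Fin d) (Fin d) ℝ}

/-- The quadratic form `xᵢᵀ M xᵢ`. -/
noncomputable def quadForm (M : Matrix (Fin d) (Fin d) ℝ) (i : Fin n) (X : Pts n d) : ℝ :=
  X i ⬝ᵥ (M *ᵥ X i)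

theorem contDiff_quadForm (i : Fin n) : ContDiff ℝ ∞ (quadForm M i : Pts n d → ℝ) := by
  have h : ∀ k, ContDiff ℝ ∞ fun X : Pts n d => X i k := fun k =>
    (contDiff_apply ℝ ℝ k).comp (contDiff_apply ℝ (Fin d → ℝ) i)
  unfold quadForm dotProduct
  simp only [Matrix.mulVec, dotProduct]
  exact ContDiff.sum fun k _ => (h k).mul (ContDiff.sum fun l _ => contDiff_const.mul (h l))

theorem vanishOrder_quadForm (i : Fin n) : VanishOrder i 2 (quadForm M i : Pts n d → ℝ) := by
  refine ⟨fun X hX => by simp [quadForm, hX], fun k => ⟨fun X hX => ?_, fun _ => trivial⟩⟩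
  have hd := ((contDiff_quadForm (M := M) i).differentiable (by simp) X).hasFDerivAt
  have hl : HasDerivAt (fun t : ℝ => X + t • (unitVec (i, k) : Pts n d)) (unitVec (i, k)) 0 := by
    simpa using ((hasDerivAt_id (0 : ℝ)).smul_const (unitVec (i, k) : Pts n d)).const_add X
  have h1 := HasFDerivAt.comp_hasDerivAt (x := (0 : ℝ))
    (f := fun t : ℝ => X + t • (unitVec (i, k) : Pts n d)) (l := quadForm M i)
    (l' := fderiv ℝ (quadForm M i) X) (by simpa using hd) hl
  have h2 : (quadForm M i ∘ fun t : ℝ => X + t • (unitVec (i, k) : Pts n d))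
      = fun t => t ^ 2 * quadForm M i (unitVec (i, k) : Pts n d) := by
    funext t
    simp only [quadForm, Function.comp, Pi.add_apply, Pi.smul_apply, hX, zero_add,
      Matrix.mulVec_smul, smul_dotProduct, dotProduct_smul, smul_eq_mul]
    ring
  rw [h2] at h1
  have h3 : HasDerivAt (fun t : ℝ => t ^ 2 * quadForm M i (unitVec (i, k) : Pts n d)) 0 0 := by
    simpa using ((hasDerivAt_pow 2 (0 : ℝ)).mul_const (quadForm M i (unitVec (i, k) : Pts n d)))
  exact h1.unique h3

theorem exists_quadForm_ge (hM : M.PosDef) :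
    ∃ c > 0, ∀ (i : Fin n) (X : Pts n d), c * ‖X i‖ ^ 2 ≤ quadForm M i X := by
  have hpos : ∀ y : Fin d → ℝ, y ≠ 0 → 0 < y ⬝ᵥ (M *ᵥ y) := fun y hy => by
    simpa using hM.dotProduct_mulVec_pos hy
  have hcont : Continuous fun y : Fin d → ℝ => y ⬝ᵥ (M *ᵥ y) := by
    unfold dotProduct; simp only [Matrix.mulVec, dotProduct]; fun_prop
  obtain ⟨c, hc, hle⟩ : ∃ c > 0, ∀ y : Fin d → ℝ, ‖y‖ = 1 → c ≤ y ⬝ᵥ (M *ᵥ y) := by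
    rcases (Metric.sphere (0 : Fin d → ℝ) 1).eq_empty_or_nonempty with h | h
    · refine ⟨1, one_pos, fun y hy => absurd (show y ∈ Metric.sphere (0 : Fin d → ℝ) 1 by
        simpa using hy) (by simp [h])⟩
    · obtain ⟨y₀, hy₀, hmin⟩ := (isCompact_sphere (0 : Fin d → ℝ) 1).exists_isMinOn h
        hcont.continuousOn
      refine ⟨_, hpos y₀ ?_, fun y hy => hmin (by simpa using hy)⟩
      rintro rfl
      simp at hy₀
  refine ⟨c, hc, fun i X => ?_⟩
  by_cases h0 : X i = 0
  · simp [quadForm, h0]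
  · have hn : 0 < ‖X i‖ := norm_pos_iff.2 h0
    have h1 := hle (‖X i‖⁻¹ • X i) (by rw [norm_smul, norm_inv, norm_norm, inv_mul_cancel₀ hn.ne'])
    simp only [Matrix.mulVec_smul, smul_dotProduct, dotProduct_smul, smul_eq_mul] at h1
    rw [← mul_assoc, ← sq, inv_pow, ← div_eq_inv_mul, le_div_iff₀ (by positivity)] at h1
    exact h1

theorem quadForm_pos (hM : M.PosDef) {i : Fin n} {X : Pts n d} (hX : X ∈ offSing n d) :
    0 < quadForm M i X := by
  simpa [quadForm] using hM.dotProduct_mulVec_pos (hX i)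

/-- Induction on the order, by `∂ Q ^ s = s Q ^ (s - 1) ∂ Q`. -/
theorem isSymbol_quadForm_rpow (hM : M.PosDef) (i : Fin n) (s : ℝ) (k : ℕ) :
    IsSymbol k (Pi.single i (2 * s)) fun (_ : P) (X : Pts n d) => quadForm M i X ^ s := by
  have hsmooth : ∀ s : ℝ, ContDiffOn ℝ ∞ (fun X : Pts n d => quadForm M i X ^ s)
      (offSing n d) := fun s =>
    (contDiff_quadForm i).contDiffOn.rpow_const_of_ne fun X hX => (quadForm_pos hM hX).ne'
  have hb : ∀ s : ℝ, WeightBound (Pi.single i (2 * s))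
      fun (_ : P) (X : Pts n d) => quadForm M i X ^ s := by
    intro s
    obtain ⟨c, hc, hlow⟩ := exists_quadForm_ge (n := n) hM
    obtain ⟨C, hC, hup⟩ := (vanishOrder_quadForm (M := M) i).exists_norm_le (contDiff_quadForm i)
    refine ⟨fun _ => hsmooth s, max (c ^ s) (C ^ s),
      le_max_of_le_left (Real.rpow_nonneg hc.le _), fun _ X hV hX => ?_⟩
    have hn : 0 < ‖X i‖ := norm_pos_iff.2 (hX i)
    have hq := quadForm_pos (i := i) hM hX
    have h1 := hlow i X
    have h2 := hup X hV
    rw [Real.norm_of_nonneg hq.le] at h2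
    have hsq : (‖X i‖ ^ 2) ^ s = ‖X i‖ ^ (2 * s) := by
      rw [← Real.rpow_natCast, ← Real.rpow_mul hn.le]; norm_num
    rw [blockWeight_single, Real.norm_of_nonneg (Real.rpow_nonneg hq.le _), ← hsq]
    rcases le_total 0 s with hs | hs
    · calc quadForm M i X ^ s ≤ (C * ‖X i‖ ^ 2) ^ s := Real.rpow_le_rpow hq.le h2 hs
        _ = C ^ s * (‖X i‖ ^ 2) ^ s := Real.mul_rpow hC (by positivity)
        _ ≤ _ := by gcongr; exact le_max_right _ _
    · calc quadForm M i X ^ s ≤ (c * ‖X i‖ ^ 2) ^ s :=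
            Real.rpow_le_rpow_of_nonpos (by positivity) h1 hs
        _ = c ^ s * (‖X i‖ ^ 2) ^ s := Real.mul_rpow hc.le (by positivity)
        _ ≤ _ := by gcongr; exact le_max_left _ _
  induction k generalizing s with
  | zero => exact hb s
  | succ k ih =>
    refine ⟨hb s, fun c => ?_⟩
    have hQ : IsSymbol (k + 1) (Pi.single i ((2 : ℕ) : ℝ)) fun _ : P => (quadForm M i : Pts n d → ℝ) :=
      (vanishOrder_quadForm i).isSymbol (contDiff_quadForm i) (k + 1)
    have h1 := ((IsSymbol.const s).mul (ih (s - 1))).mul (hQ.2 c)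
    have he : (0 + Pi.single i (2 * (s - 1)) + (Pi.single i ((2 : ℕ) : ℝ) - Pi.single c.1 1)
        : Fin n → ℝ) = Pi.single i (2 * s) - Pi.single c.1 1 := by
      rw [zero_add, ← add_sub_assoc, ← Pi.single_add]
      congr 2
      push_cast
      ring
    rw [he] at h1
    refine h1.congr fun _ X hX => ?_
    have hd := ((contDiff_quadForm (M := M) i).differentiable (by simp) X).hasFDerivAt
    have := hd.rpow_const (p := s) (Or.inl (quadForm_pos hM hX).ne')
    simp only [dirDeriv, this.fderiv]
    rfl

end quadratic

/-! ### Cutting off the singularities -/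

section cutoff

variable {𝕜 : Type*} [RCLike 𝕜] {n d : ℕ}

theorem hasFDerivAt_comp_block {E : Type*} [NormedAddCommGroup E] [NormedSpace ℝ E]
    {ψ : (Fin d → ℝ) → E} (hψ : ContDiff ℝ ∞ ψ) (i : Fin n) (r : ℝ) (X : Pts n d) :
    HasFDerivAt (fun X : Pts n d => ψ (r • X i))
      ((fderiv ℝ ψ (r • X i)).comp
        (r • ContinuousLinearMap.proj (R := ℝ) (φ := fun _ : Fin n => Fin d → ℝ) i)) X := by
  have h1 : HasFDerivAt (fun X : Pts n d => r • X i)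
      (r • ContinuousLinearMap.proj (R := ℝ) (φ := fun _ : Fin n => Fin d → ℝ) i) X :=
    (r • ContinuousLinearMap.proj (R := ℝ) (φ := fun _ : Fin n => Fin d → ℝ) i).hasFDerivAt
  exact (hψ.differentiable (by simp) (r • X i)).hasFDerivAt.comp X h1

theorem contDiff_comp_block {ψ : (Fin d → ℝ) → ℝ} (hψ : ContDiff ℝ ∞ ψ) (i : Fin n) (r : ℝ) :
    ContDiff ℝ ∞ fun X : Pts n d => ψ (r • X i) :=
  hψ.comp ((contDiff_apply ℝ (Fin d → ℝ) i).const_smul r)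

/-- Rescaled compactly supported functions are symbols, uniformly in the scale. -/
theorem isSymbol_rescaled {ψ : (Fin d → ℝ) → ℝ} (hψ : ContDiff ℝ ∞ ψ) (hc : HasCompactSupport ψ)
    (i : Fin n) (j k : ℕ) :
    IsSymbol k (Pi.single i (-(j : ℝ))) fun (ε : Set.Ioi (0 : ℝ)) (X : Pts n d) =>
      ((ε : ℝ)⁻¹) ^ j * ψ ((ε : ℝ)⁻¹ • X i) := by
  have hb : ∀ {ψ : (Fin d → ℝ) → ℝ} {j : ℕ}, ContDiff ℝ ∞ ψ → HasCompactSupport ψ →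
      WeightBound (Pi.single i (-(j : ℝ))) fun (ε : Set.Ioi (0 : ℝ)) (X : Pts n d) =>
        ((ε : ℝ)⁻¹) ^ j * ψ ((ε : ℝ)⁻¹ • X i) := by
    intro ψ j hψ hc
    have hcs : HasCompactSupport fun y => ‖y‖ ^ j * ψ y := hc.mul_left
    obtain ⟨C, hC⟩ := hcs.exists_bound_of_continuous
      ((continuous_norm.pow j).mul hψ.continuous)
    refine ⟨fun ε => (contDiff_const.mul (contDiff_comp_block hψ i _)).contDiffOn, max C 0,
      le_max_right _ _, fun ε X _ hX => ?_⟩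
    have hε : (0 : ℝ) < ε := ε.2
    have hn : 0 < ‖X i‖ := norm_pos_iff.2 (hX i)
    have h1 := hC ((ε : ℝ)⁻¹ • X i)
    rw [norm_mul, norm_pow, norm_norm, norm_smul, norm_inv, Real.norm_of_nonneg hε.le, mul_pow] at h1
    rw [blockWeight_single, Real.rpow_neg hn.le, Real.rpow_natCast, ← div_eq_mul_inv,
      le_div_iff₀ (by positivity), norm_mul, norm_pow, norm_inv, Real.norm_of_nonneg hε.le]
    calc _ = _ := by ring
      _ ≤ C := h1
      _ ≤ _ := le_max_left _ _
  induction k generalizing ψ j with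
  | zero => exact hb hψ hc
  | succ k ih =>
    refine ⟨hb hψ hc, fun c => ?_⟩
    have hψ' := contDiff_dirDeriv (Pi.single c.2 1) hψ
    have hc' : HasCompactSupport (dirDeriv (Pi.single c.2 1) ψ) := hc.fderiv_apply (𝕜 := ℝ) _
    have hd : ∀ (ε : Set.Ioi (0 : ℝ)) (X : Pts n d),
        dirDeriv (unitVec c) (fun X : Pts n d => ((ε : ℝ)⁻¹) ^ j * ψ ((ε : ℝ)⁻¹ • X i)) X
          = ((ε : ℝ)⁻¹) ^ j * fderiv ℝ ψ ((ε : ℝ)⁻¹ • X i)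
              ((ε : ℝ)⁻¹ • (unitVec c : Pts n d) i) := by
      intro ε X
      rw [dirDeriv, ((hasFDerivAt_comp_block hψ i (ε : ℝ)⁻¹ X).const_mul _).fderiv]
      rfl
    by_cases hci : c.1 = i
    · subst hci
      have he : (Pi.single c.1 (-(j : ℝ)) - Pi.single c.1 1 : Fin n → ℝ)
          = Pi.single c.1 (-((j + 1 : ℕ) : ℝ)) := by
        rw [← Pi.single_sub]; congr 1; push_cast; ring
      rw [he]
      refine (ih hψ' hc' (j + 1)).congr fun ε X _ => ?_
      rw [hd]
      have : (unitVec c : Pts n d) c.1 = Pi.single c.2 1 := by simp [unitVec]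
      rw [this, map_smul, smul_eq_mul]
      simp only [dirDeriv]
      ring
    · refine ((ih (ψ := fun _ => 0) contDiff_const HasCompactSupport.zero j).mono
        (sub_le_self _ (Pi.single_nonneg.2 zero_le_one))).congr fun ε X _ => ?_
      rw [hd]
      have : (unitVec c : Pts n d) i = 0 := by
        unfold unitVec; exact Pi.single_eq_of_ne (Ne.symm hci) _
      simp [this]

/-- A smooth bump function on `ℝ^d`: equal to `1` for `‖y‖ ≤ 1/2` and to `0` for `‖y‖ ≥ 1`. -/
noncomputable def originBump (d : ℕ) : ContDiffBump (0 : Fin d → ℝ) :=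
  ⟨1 / 2, 1, by norm_num, by norm_num⟩

/-- The cutoff function at scale `ε`: it vanishes where `‖xᵢ‖ ≤ ε/2` for some `i`, and equals `1`
where `‖xᵢ‖ ≥ ε` for all `i`. -/
noncomputable def cutoff (ε : ℝ) (X : Pts n d) : ℝ := ∏ i, (1 - originBump d (ε⁻¹ • X i))

theorem contDiff_cutoff (ε : ℝ) : ContDiff ℝ ∞ (cutoff ε : Pts n d → ℝ) :=
  contDiff_prod fun i _ => contDiff_const.sub (contDiff_comp_block (originBump d).contDiff i _)

theorem cutoff_eq_zero {ε : ℝ} (hε : 0 < ε) {X : Pts n d} {i : Fin n} (h : ‖X i‖ ≤ ε / 2) :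
    cutoff ε X = 0 := by
  refine Finset.prod_eq_zero (Finset.mem_univ i) ?_
  rw [(originBump d).one_of_mem_closedBall, sub_self]
  rw [mem_closedBall_zero_iff, norm_smul, norm_inv, Real.norm_of_nonneg hε.le, inv_mul_le_iff₀ hε]
  simp only [originBump]
  linarith

theorem originBump_eq_zero {ε : ℝ} (hε : 0 < ε) {y : Fin d → ℝ} (h : ε ≤ ‖y‖) :
    originBump d (ε⁻¹ • y) = 0 := by
  apply (originBump d).zero_of_le_dist
  rw [dist_zero_right, norm_smul, norm_inv, Real.norm_of_nonneg hε.le, le_inv_mul_iff₀ hε]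
  simpa [originBump] using h

theorem cutoff_eq_one {ε : ℝ} (hε : 0 < ε) {X : Pts n d} (h : ∀ i, ε ≤ ‖X i‖) :
    cutoff ε X = 1 :=
  Finset.prod_eq_one fun i _ => by rw [originBump_eq_zero hε (h i), sub_zero]

theorem cutoff_nonneg (ε : ℝ) (X : Pts n d) : 0 ≤ cutoff ε X :=
  Finset.prod_nonneg fun _ _ => sub_nonneg.2 (originBump d).le_one

theorem cutoff_le_one (ε : ℝ) (X : Pts n d) : cutoff ε X ≤ 1 :=
  Finset.prod_le_one (fun _ _ => sub_nonneg.2 (originBump d).le_one)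
    fun _ _ => sub_le_self _ (originBump d).nonneg

theorem isSymbol_cutoff (k : ℕ) :
    IsSymbol k 0 fun (ε : Set.Ioi (0 : ℝ)) (X : Pts n d) => ((cutoff (ε : ℝ) X : ℝ) : 𝕜) := by
  have h1 : ∀ i ∈ Finset.univ, IsSymbol k (0 : Fin n → ℝ) fun (ε : Set.Ioi (0 : ℝ)) (X : Pts n d) =>
      1 - originBump d ((ε : ℝ)⁻¹ • X i) := by
    intro i _
    have h2 := isSymbol_rescaled (originBump d).contDiff (originBump d).hasCompactSupport i 0 k
    simp only [Nat.cast_zero, neg_zero, Pi.single_zero] at h2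
    refine ((IsSymbol.const (1 : ℝ)).add (h2.clm_comp (-ContinuousLinearMap.id ℝ ℝ))).congr
      fun ε X _ => ?_
    simp [sub_eq_add_neg]
  have h3 := IsSymbol.prod Finset.univ h1
  rw [Finset.sum_const_zero] at h3
  exact h3.clm_comp (RCLike.ofRealCLM (K := 𝕜))

/-- The cutoff function is locally periodic at the boundary of `V^{×n}`. -/
theorem cutoff_eventuallyEq_translate {ε : ℝ} (hε : 0 < ε) (hε2 : ε < 1 / 2) {c : Fin n × Fin d}
    {X : Pts n d} (hX : X c.1 c.2 = -1 / 2) :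
    cutoff ε =ᶠ[nhds X] fun Y => cutoff ε (Y + unitVec c) := by
  have hcont : Continuous fun Y : Pts n d => Y c.1 c.2 :=
    (continuous_apply c.2).comp (continuous_apply c.1)
  have h1 : ∀ᶠ Y in nhds X, Y c.1 c.2 < -ε :=
    hcont.continuousAt.eventually_lt_const (by simp only [hX]; linarith)
  have h2 : ∀ᶠ Y in nhds X, ε - 1 < Y c.1 c.2 :=
    hcont.continuousAt.eventually_const_lt (by simp only [hX]; linarith)
  filter_upwards [h1, h2] with Y hY1 hY2
  refine Finset.prod_congr rfl fun i _ => ?_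
  by_cases hi : i = c.1
  · subst hi
    rw [originBump_eq_zero hε, originBump_eq_zero hε]
    · refine le_trans ?_ (norm_le_pi_norm _ c.2)
      rw [Pi.add_apply, Pi.add_apply, unitVec_apply, if_pos rfl]
      exact (by linarith : ε ≤ Y c.1 c.2 + 1).trans (le_abs_self _)
    · refine le_trans ?_ (norm_le_pi_norm _ c.2)
      exact (by linarith : ε ≤ - Y c.1 c.2).trans (neg_le_abs _)
  · have : (unitVec c : Pts n d) i = 0 := by unfold unitVec; exact Pi.single_eq_of_ne hi _
    rw [Pi.add_apply, this, add_zero]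

/-- `u` multiplied by the cutoff function at scale `ε`. -/
noncomputable def cutProd (u : Pts n d → 𝕜) (ε : ℝ) (X : Pts n d) : 𝕜 :=
  u X * ((cutoff ε X : ℝ) : 𝕜)

theorem cutProd_eventuallyEq_zero (u : Pts n d → 𝕜) {ε : ℝ} (hε : 0 < ε) {X : Pts n d}
    (hX : X ∉ offSing n d) : cutProd u ε =ᶠ[nhds X] fun _ => 0 := by
  obtain ⟨i, hi⟩ : ∃ i, X i = 0 := by simpa [offSing] using hX
  have : ∀ᶠ Y : Pts n d in nhds X, ‖Y i‖ < ε / 2 :=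
    (continuous_apply i).norm.continuousAt.eventually_lt_const (by simpa [hi] using hε)
  filter_upwards [this] with Y hY
  simp [cutProd, cutoff_eq_zero hε hY.le]

theorem contDiff_ofReal_cutoff (ε : ℝ) :
    ContDiff ℝ ∞ fun X : Pts n d => ((cutoff ε X : ℝ) : 𝕜) :=
  (RCLike.ofRealCLM (K := 𝕜)).contDiff.comp (contDiff_cutoff ε)

theorem contDiff_cutProd {u : Pts n d → 𝕜} (hu : ContDiffOn ℝ ∞ u (offSing n d)) {ε : ℝ}
    (hε : 0 < ε) : ContDiff ℝ ∞ (cutProd u ε) := by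
  rw [contDiff_iff_contDiffAt]
  intro X
  by_cases hX : X ∈ offSing n d
  · exact (hu.contDiffAt (isOpen_offSing.mem_nhds hX)).mul (contDiff_ofReal_cutoff ε).contDiffAt
  · exact contDiffAt_const.congr_of_eventuallyEq (cutProd_eventuallyEq_zero u hε hX)

theorem isSymbol_cutProd {u : Pts n d → 𝕜} {e : Fin n → ℝ} {k : ℕ}
    (hu : IsSymbol k e fun _ : Set.Ioi (0 : ℝ) => u) :
    IsSymbol k e fun (ε : Set.Ioi (0 : ℝ)) => cutProd u (ε : ℝ) := by
  have h := hu.mul (isSymbol_cutoff (𝕜 := 𝕜) k)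
  rwa [add_zero] at h

/-! ### Matching of jets at opposite boundary points -/

/-- The partial derivatives of `u` up to order `k` agree at `X` and `X'`. -/
def JetEq (X X' : Pts n d) : ℕ → (Pts n d → 𝕜) → Prop
  | 0, u => u X = u X'
  | k + 1, u => u X = u X' ∧ ∀ c, JetEq X X' k (dirDeriv (unitVec c) u)

namespace JetEq

variable {X X' : Pts n d} {k : ℕ} {u v : Pts n d → 𝕜}

theorem apply_eq (h : JetEq X X' k u) : u X = u X' := by
  cases k with
  | zero => exact h
  | succ k => exact h.1

theorem of_succ (h : JetEq X X' (k + 1) u) : JetEq X X' k u := by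
  induction k generalizing u with
  | zero => exact h.1
  | succ k ih => exact ⟨h.1, fun c => ih (h.2 c)⟩

theorem congr (hX : X ∈ offSing n d) (hX' : X' ∈ offSing n d) (h : JetEq X X' k u)
    (huv : Set.EqOn v u (offSing n d)) : JetEq X X' k v := by
  induction k generalizing u v with
  | zero => exact (huv hX).trans (h.apply_eq.trans (huv hX').symm)
  | succ k ih =>
    exact ⟨(huv hX).trans (h.apply_eq.trans (huv hX').symm), fun c =>
      ih (h.2 c) (dirDeriv_congr_on isOpen_offSing huv _)⟩

theorem add (hX : X ∈ offSing n d) (hX' : X' ∈ offSing n d) (hu : JetEq X X' k u)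
    (hv : JetEq X X' k v) (hus : ContDiffOn ℝ ∞ u (offSing n d))
    (hvs : ContDiffOn ℝ ∞ v (offSing n d)) : JetEq X X' k fun Y => u Y + v Y := by
  have h0 : u X + v X = u X' + v X' := by rw [hu.apply_eq, hv.apply_eq]
  induction k generalizing u v with
  | zero => exact h0
  | succ k ih =>
    refine ⟨h0, fun c => ?_⟩
    have hus' := contDiffOn_dirDeriv isOpen_offSing hus (unitVec c)
    have hvs' := contDiffOn_dirDeriv isOpen_offSing hvs (unitVec c)
    refine (ih (hu.2 c) (hv.2 c) hus' hvs' ?_).congr hX hX' fun Y hY => ?_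
    · rw [(hu.2 c).apply_eq, (hv.2 c).apply_eq]
    · have hn := isOpen_offSing.mem_nhds hY
      simp only [dirDeriv]
      rw [fderiv_fun_add ((hus.contDiffAt hn).differentiableAt (by simp))
        ((hvs.contDiffAt hn).differentiableAt (by simp))]
      rfl

theorem mul (hX : X ∈ offSing n d) (hX' : X' ∈ offSing n d) (hu : JetEq X X' k u)
    (hv : JetEq X X' k v) (hus : ContDiffOn ℝ ∞ u (offSing n d))
    (hvs : ContDiffOn ℝ ∞ v (offSing n d)) : JetEq X X' k fun Y => u Y * v Y := by
  have h0 : u X * v X = u X' * v X' := by rw [hu.apply_eq, hv.apply_eq]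
  induction k generalizing u v with
  | zero => exact h0
  | succ k ih =>
    refine ⟨h0, fun c => ?_⟩
    have hus' := contDiffOn_dirDeriv isOpen_offSing hus (unitVec c)
    have hvs' := contDiffOn_dirDeriv isOpen_offSing hvs (unitVec c)
    have h1 := ih (hu.2 c) hv.of_succ hus' hvs (by rw [(hu.2 c).apply_eq, hv.apply_eq])
    have h2 := ih hu.of_succ (hv.2 c) hus hvs' (by rw [hu.apply_eq, (hv.2 c).apply_eq])
    refine (h1.add hX hX' h2 (hus'.mul hvs) (hus.mul hvs')).congr hX hX' fun Y hY => ?_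
    have hn := isOpen_offSing.mem_nhds hY
    simp only [dirDeriv]
    rw [fderiv_fun_mul ((hus.contDiffAt hn).differentiableAt (by simp))
      ((hvs.contDiffAt hn).differentiableAt (by simp))]
    simp only [add_apply, smul_apply, smul_eq_mul]
    ring

theorem of_eventuallyEq_translate {w : Pts n d} (h : u =ᶠ[nhds X] fun Y => u (Y + w)) (k : ℕ) :
    JetEq X (X + w) k u := by
  induction k generalizing u with
  | zero => exact h.eq_of_nhds
  | succ k ih =>
    refine ⟨h.eq_of_nhds, fun c => ih ?_⟩
    filter_upwards [h.eventuallyEq_nhds] with Y hY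
    simp only [dirDeriv]
    rw [hY.fderiv_eq, fderiv_comp_add_right]

theorem of_mixedPartial (hX : X ∈ offSing n d) (hX' : X' ∈ offSing n d)
    (hus : ContDiffOn ℝ ∞ u (offSing n d))
    (h : ∀ (s : ℕ) (c : Fin s → Fin n × Fin d), mixedPartial c u X = mixedPartial c u X') (k : ℕ) :
    JetEq X X' k u := by
  have h0 : u X = u X' := by simpa [mixedPartial_zero] using h 0 Fin.elim0
  induction k generalizing u with
  | zero => exact h0
  | succ k ih =>
    have h1 : ∀ b (s : ℕ) (c : Fin s → Fin n × Fin d),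
        mixedPartial c (dirDeriv (unitVec b) u) X = mixedPartial c (dirDeriv (unitVec b) u) X' := by
      intro b s c
      have := h (s + 1) (Fin.snoc (α := fun _ => Fin n × Fin d) c b)
      rw [mixedPartial_succ _ (hus.contDiffAt (isOpen_offSing.mem_nhds hX)),
        mixedPartial_succ _ (hus.contDiffAt (isOpen_offSing.mem_nhds hX')),
        Fin.snoc_last, Fin.init_snoc] at this
      exact this
    exact ⟨h0, fun b => ih (contDiffOn_dirDeriv isOpen_offSing hus _) (h1 b)
      (by simpa [mixedPartial_zero] using h1 b 0 Fin.elim0)⟩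

theorem mixedPartial_eq (hX : X ∈ offSing n d) (hX' : X' ∈ offSing n d)
    (hus : ContDiffOn ℝ ∞ u (offSing n d)) (h : JetEq X X' k u) (c : Fin k → Fin n × Fin d) :
    mixedPartial c u X = mixedPartial c u X' := by
  induction k generalizing u with
  | zero => simpa [mixedPartial_zero] using h.apply_eq
  | succ k ih =>
    rw [mixedPartial_succ _ (hus.contDiffAt (isOpen_offSing.mem_nhds hX)),
      mixedPartial_succ _ (hus.contDiffAt (isOpen_offSing.mem_nhds hX'))]
    exact ih (contDiffOn_dirDeriv isOpen_offSing hus _) (h.2 _) _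

end JetEq

/-- The cut off function inherits the periodic boundary condition. -/
theorem ptsFaceMatch_mixedPartial_cutProd {u : Pts n d → 𝕜} (hu : ContDiffOn ℝ ∞ u (offSing n d))
    (hper : PeriodicBoundary u) {ε : ℝ} (hε : 0 < ε) (hε2 : ε < 1 / 2) {s : ℕ}
    (c : Fin s → Fin n × Fin d) (b : Fin n × Fin d) :
    PtsFaceMatch b (mixedPartial c (cutProd u ε)) := by
  intro X hV hXb
  have hmem : X + unitVec b ∈ offSing n d ↔ X ∈ offSing n d := by
    refine forall_congr' fun i => ?_
    by_cases hi : i = b.1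
    · subst hi
      refine iff_of_true (fun h => ?_) (fun h => ?_)
      · have := congrFun h b.2
        rw [Pi.add_apply, Pi.add_apply, unitVec_apply, if_pos rfl, hXb] at this
        norm_num at this
      · rw [h] at hXb; norm_num at hXb
    · have : (unitVec b : Pts n d) i = 0 := by unfold unitVec; exact Pi.single_eq_of_ne hi _
      rw [Pi.add_apply, this, add_zero]
  by_cases hX : X ∈ offSing n d
  · have hX' := hmem.2 hX
    have hcs := (contDiff_ofReal_cutoff (𝕜 := 𝕜) (n := n) (d := d) ε).contDiffOn
      (s := offSing n d)
    have h1 := JetEq.of_mixedPartial hX hX' hu (fun s c => hper b.1 b.2 X hV hXb hX s c) s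
    have h2 : JetEq X (X + unitVec b) s fun X : Pts n d => ((cutoff ε X : ℝ) : 𝕜) :=
      JetEq.of_eventuallyEq_translate (by
        filter_upwards [cutoff_eventuallyEq_translate hε hε2 hXb] with Y hY
        rw [hY]) s
    exact (h1.mul hX hX' h2 hu hcs).mixedPartial_eq hX hX' (hu.mul hcs) c
  -- Where some `xᵢ` vanishes, both derivatives are zero.
  · have hz : ∀ Y, Y ∉ offSing n d → mixedPartial c (cutProd u ε) Y = 0 := by
      intro Y hY
      have := ((cutProd_eventuallyEq_zero u hε hY).iteratedFDeriv ℝ s).eq_of_nhds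
      rw [mixedPartial, this]
      simp
    rw [hz X hX, hz _ (hmem.not.2 hX)]

end cutoff

/-! ### Integrals of the weights -/

section radial

variable {d : ℕ}

theorem integrableOn_norm_rpow_ball (hd : 0 < d) {e : ℝ} (he : -(d : ℝ) < e) (r : ℝ) :
    IntegrableOn (fun y : Fin d → ℝ => ‖y‖ ^ e) (Metric.ball 0 r) := by
  have : Nonempty (Fin d) := ⟨⟨0, hd⟩⟩
  rw [integrableOn_fun_norm_addHaar volume (f := fun y : ℝ => y ^ e)]
  have h1 : IntegrableOn (fun y : ℝ => y ^ (d - 1 + e)) (Set.Ioo 0 r) := by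
    rcases le_or_gt r 0 with hr | hr
    · rw [Set.Ioo_eq_empty (not_lt.2 hr)]; exact integrableOn_empty
    · exact (intervalIntegral.integrableOn_Ioo_rpow_iff hr).2 (by linarith)
  refine h1.congr_fun (fun y hy => ?_) measurableSet_Ioo
  rw [Module.finrank_fin_fun, smul_eq_mul, ← Real.rpow_natCast, ← Real.rpow_add hy.1]
  rw [Nat.cast_sub hd, Nat.cast_one]

theorem integrableOn_norm_rpow_compl_ball (hd : 0 < d) {e : ℝ} (he : e < -(d : ℝ)) {r : ℝ}
    (hr : 0 < r) :
    IntegrableOn (fun y : Fin d → ℝ => ‖y‖ ^ e) {y | r ≤ ‖y‖} := by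
  have : Nonempty (Fin d) := ⟨⟨0, hd⟩⟩
  have hmeas : MeasurableSet {y : Fin d → ℝ | r ≤ ‖y‖} :=
    (isClosed_le continuous_const continuous_norm).measurableSet
  rw [← integrable_indicator_iff hmeas]
  have h0 : Set.indicator {y : Fin d → ℝ | r ≤ ‖y‖} (fun y => ‖y‖ ^ e)
      = fun y : Fin d → ℝ => Set.indicator (Set.Ici r) (fun t : ℝ => t ^ e) ‖y‖ := by
    funext y
    by_cases h : r ≤ ‖y‖ <;> simp [Set.indicator, h]
  rw [h0, integrable_fun_norm_addHaar volume (f := Set.indicator (Set.Ici r) fun t : ℝ => t ^ e)]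
  have h1 : IntegrableOn (fun y : ℝ => y ^ (d - 1 + e)) (Set.Ici r) := by
    rw [integrableOn_Ici_iff_integrableOn_Ioi]
    exact integrableOn_Ioi_rpow_of_lt (by linarith) hr
  have h2 := (integrable_indicator_iff measurableSet_Ici).2 h1
  refine h2.integrableOn.congr_fun (fun y hy => ?_) measurableSet_Ioi
  by_cases h : r ≤ y
  · simp only [Set.indicator, Set.mem_Ici, h, if_true]
    rw [Module.finrank_fin_fun, smul_eq_mul, ← Real.rpow_natCast, ← Real.rpow_add hy]
    congr 2
    rw [Nat.cast_sub hd, Nat.cast_one]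
  · simp [Set.indicator, h]

open scoped Pointwise in
/-- The behaviour under scaling of the integral of a power of the norm over a radial set. -/
theorem setIntegral_norm_rpow_smul {e : ℝ} {r : ℝ} (hr : 0 < r) {p : ℝ → Prop} :
    ∫ y in {y : Fin d → ℝ | p (r⁻¹ * ‖y‖)}, ‖y‖ ^ e
      = r ^ (e + d) * ∫ y in {y : Fin d → ℝ | p ‖y‖}, ‖y‖ ^ e := by
  have hset : r • {y : Fin d → ℝ | p ‖y‖} = {y : Fin d → ℝ | p (r⁻¹ * ‖y‖)} := by
    ext y
    rw [Set.mem_smul_set_iff_inv_smul_mem₀ hr.ne']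
    simp only [Set.mem_ofPred_eq, norm_smul, norm_inv, Real.norm_of_nonneg hr.le]
  have h := Measure.setIntegral_comp_smul_of_pos volume (fun y : Fin d → ℝ => ‖y‖ ^ e)
    {y : Fin d → ℝ | p ‖y‖} hr
  rw [hset, Module.finrank_fin_fun] at h
  have h2 : ∀ y : Fin d → ℝ, ‖r • y‖ ^ e = r ^ e * ‖y‖ ^ e := fun y => by
    rw [norm_smul, Real.norm_of_nonneg hr.le, Real.mul_rpow hr.le (norm_nonneg _)]
  simp only [h2] at h
  rw [integral_const_mul, smul_eq_mul, eq_inv_mul_iff_mul_eq₀ (by positivity)] at h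
  rw [← h, Real.rpow_add hr, Real.rpow_natCast]
  ring

end radial

section weights

variable {n d : ℕ}

theorem unitCube_subset_ball : unitCube (Fin d) ⊆ Metric.ball 0 1 := by
  intro y hy
  rw [mem_ball_zero_iff]
  refine lt_of_le_of_lt ((pi_norm_le_iff_of_nonneg (by norm_num : (0 : ℝ) ≤ 1 / 2)).2
    fun k => ?_) (by norm_num : (1 / 2 : ℝ) < 1)
  have := hy k
  rw [Real.norm_eq_abs, abs_le]
  constructor <;> linarith [this.1, this.2]

theorem cubeV_inter_block (i : Fin n) (T : Set (Fin d → ℝ)) :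
    cubeV n d ∩ {X | X i ∈ T}
      = Set.univ.pi fun j => if j = i then unitCube (Fin d) ∩ T else unitCube (Fin d) := by
  ext X
  simp only [Set.mem_univ_pi]
  constructor
  · rintro ⟨h, hT⟩ j
    split_ifs with hj
    · subst hj; exact ⟨h j, hT⟩
    · exact h j
  · intro h
    have hi := h i
    rw [if_pos rfl] at hi
    refine ⟨fun j => ?_, hi.2⟩
    have hj := h j
    split_ifs at hj with hji
    · exact hj.1
    · exact hj

theorem volume_restrict_pi (S : Fin n → Set (Fin d → ℝ)) :
    (volume : Measure (Pts n d)).restrict (Set.univ.pi S)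
      = Measure.pi fun i => volume.restrict (S i) := by
  rw [volume_pi, Measure.restrict_pi_pi]

theorem integrableOn_blockWeight_inter {e : Fin n → ℝ} {i : Fin n} {T : Set (Fin d → ℝ)}
    (hi : IntegrableOn (fun y : Fin d → ℝ => ‖y‖ ^ e i) (unitCube (Fin d) ∩ T))
    (hj : ∀ j, j ≠ i → IntegrableOn (fun y : Fin d → ℝ => ‖y‖ ^ e j) (unitCube (Fin d))) :
    IntegrableOn (blockWeight e) (cubeV n d ∩ {X | X i ∈ T}) := by
  rw [cubeV_inter_block, IntegrableOn, volume_restrict_pi]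
  refine Integrable.fintype_prod (f := fun j (y : Fin d → ℝ) => ‖y‖ ^ e j) fun j => ?_
  split_ifs with h
  · subst h; exact hi
  · exact hj j h

theorem setIntegral_blockWeight_inter (e : Fin n → ℝ) (i : Fin n) (T : Set (Fin d → ℝ)) :
    ∫ X in cubeV n d ∩ {X | X i ∈ T}, blockWeight e X
      = (∫ y in unitCube (Fin d) ∩ T, ‖y‖ ^ e i)
        * ∏ j ∈ Finset.univ.erase i, ∫ y in unitCube (Fin d), ‖y‖ ^ e j := by
  rw [cubeV_inter_block, volume_restrict_pi]
  simp only [blockWeight]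
  rw [integral_fintype_prod_eq_prod (fun j (y : Fin d → ℝ) => ‖y‖ ^ e j),
    ← Finset.mul_prod_erase _ _ (Finset.mem_univ i), if_pos rfl]
  congr 1
  refine Finset.prod_congr rfl fun j hj => ?_
  rw [if_neg (Finset.ne_of_mem_erase hj)]

theorem integrableOn_norm_rpow_unitCube (hd : 0 < d) {e : ℝ} (he : -(d : ℝ) < e) :
    IntegrableOn (fun y : Fin d → ℝ => ‖y‖ ^ e) (unitCube (Fin d)) :=
  (integrableOn_norm_rpow_ball hd he 1).mono_set unitCube_subset_ball

theorem integrableOn_blockWeight (hd : 0 < d) {e : Fin n → ℝ} (he : ∀ i, -(d : ℝ) < e i) :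
    IntegrableOn (blockWeight e) (cubeV n d) := by
  have hset : cubeV n d = Set.univ.pi fun _ => unitCube (Fin d) := by
    ext X; simp [cubeV, unitCube]
  rw [hset, IntegrableOn, volume_restrict_pi]
  exact Integrable.fintype_prod (f := fun j (y : Fin d → ℝ) => ‖y‖ ^ e j)
    fun j => integrableOn_norm_rpow_unitCube hd (he j)

theorem setIntegral_rpow_nonneg (e : ℝ) (S : Set (Fin d → ℝ)) : 0 ≤ ∫ y in S, ‖y‖ ^ e :=
  integral_nonneg fun _ => Real.rpow_nonneg (norm_nonneg _) _

/-- The weight has a small integral over the points for which `xᵢ` is near zero. -/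
theorem exists_integral_blockWeight_near_le (hd : 0 < d) {e : Fin n → ℝ}
    (he : ∀ i, -(d : ℝ) < e i) (i : Fin n) :
    ∃ C, 0 ≤ C ∧ ∀ ε : ℝ, 0 < ε →
      ∫ X in cubeV n d ∩ {X | ‖X i‖ < ε}, blockWeight e X ≤ C * ε ^ (e i + d) := by
  let K := ∏ j ∈ Finset.univ.erase i, ∫ y in unitCube (Fin d), ‖y‖ ^ e j
  have hK : 0 ≤ K := Finset.prod_nonneg fun _ _ => setIntegral_rpow_nonneg _ _
  refine ⟨(∫ y in {y : Fin d → ℝ | ‖y‖ < 1}, ‖y‖ ^ e i) * K,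
    mul_nonneg (setIntegral_rpow_nonneg _ _) hK, fun ε hε => ?_⟩
  have h := setIntegral_blockWeight_inter e i {y : Fin d → ℝ | ‖y‖ < ε}
  have hset : {y : Fin d → ℝ | ‖y‖ < ε} = {y : Fin d → ℝ | ε⁻¹ * ‖y‖ < 1} := by
    ext y; simp only [Set.mem_ofPred_eq]; rw [inv_mul_lt_iff₀ hε, mul_one]
  have hball : {y : Fin d → ℝ | ‖y‖ < ε} = Metric.ball 0 ε := by ext y; simp
  have h1 : ∫ y in unitCube (Fin d) ∩ {y | ‖y‖ < ε}, ‖y‖ ^ e i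
      ≤ ε ^ (e i + d) * ∫ y in {y : Fin d → ℝ | ‖y‖ < 1}, ‖y‖ ^ e i := by
    rw [← setIntegral_norm_rpow_smul hε (p := fun t => t < 1), ← hset]
    refine setIntegral_mono_set ?_ ?_ Set.inter_subset_right.eventuallyLE
    · rw [hball]; exact integrableOn_norm_rpow_ball hd (he i) ε
    · exact ae_of_all _ fun _ => Real.rpow_nonneg (norm_nonneg _) _
  calc _ = (∫ y in unitCube (Fin d) ∩ {y | ‖y‖ < ε}, ‖y‖ ^ e i) * K := h
    _ ≤ (ε ^ (e i + d) * ∫ y in {y : Fin d → ℝ | ‖y‖ < 1}, ‖y‖ ^ e i) * K := by gcongr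
    _ = _ := by ring

/-- The integral of a weight that is not integrable in `xᵢ`, over the points for which `xᵢ` stays
away from zero. -/
theorem exists_integral_blockWeight_far_le (hd : 0 < d) {e : Fin n → ℝ} {i : Fin n}
    (hi : e i < -(d : ℝ)) (he : ∀ j, j ≠ i → -(d : ℝ) < e j) :
    ∃ C, 0 ≤ C ∧ ∀ r : ℝ, 0 < r →
      IntegrableOn (blockWeight e) (cubeV n d ∩ {X | r ≤ ‖X i‖}) ∧
      ∫ X in cubeV n d ∩ {X | r ≤ ‖X i‖}, blockWeight e X ≤ C * r ^ (e i + d) := by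
  let K := ∏ j ∈ Finset.univ.erase i, ∫ y in unitCube (Fin d), ‖y‖ ^ e j
  have hK : 0 ≤ K := Finset.prod_nonneg fun _ _ => setIntegral_rpow_nonneg _ _
  refine ⟨(∫ y in {y : Fin d → ℝ | 1 ≤ ‖y‖}, ‖y‖ ^ e i) * K,
    mul_nonneg (setIntegral_rpow_nonneg _ _) hK, fun r hr => ?_⟩
  have hint := integrableOn_norm_rpow_compl_ball hd hi hr
  refine ⟨integrableOn_blockWeight_inter (T := {y | r ≤ ‖y‖})
    (hint.mono_set Set.inter_subset_right)
    (fun j hj => integrableOn_norm_rpow_unitCube hd (he j hj)), ?_⟩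
  have h := setIntegral_blockWeight_inter e i {y : Fin d → ℝ | r ≤ ‖y‖}
  have hset : {y : Fin d → ℝ | r ≤ ‖y‖} = {y : Fin d → ℝ | 1 ≤ r⁻¹ * ‖y‖} := by
    ext y; simp only [Set.mem_ofPred_eq]; rw [le_inv_mul_iff₀ hr, mul_one]
  have h1 : ∫ y in unitCube (Fin d) ∩ {y | r ≤ ‖y‖}, ‖y‖ ^ e i
      ≤ r ^ (e i + d) * ∫ y in {y : Fin d → ℝ | 1 ≤ ‖y‖}, ‖y‖ ^ e i := by
    rw [← setIntegral_norm_rpow_smul hr (p := fun t => 1 ≤ t), ← hset]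
    exact setIntegral_mono_set hint (ae_of_all _ fun _ => Real.rpow_nonneg (norm_nonneg _) _)
      Set.inter_subset_right.eventuallyLE
  calc _ = (∫ y in unitCube (Fin d) ∩ {y | r ≤ ‖y‖}, ‖y‖ ^ e i) * K := h
    _ ≤ (r ^ (e i + d) * ∫ y in {y : Fin d → ℝ | 1 ≤ ‖y‖}, ‖y‖ ^ e i) * K := by gcongr
    _ = _ := by ring

theorem ae_mem_offSing (hd : 0 < d) : ∀ᵐ X : Pts n d, X ∈ offSing n d := by
  have : Nonempty (Fin d) := ⟨⟨0, hd⟩⟩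
  refine ae_all_iff.2 fun i => ?_
  exact compl_mem_ae_iff.2 (Measure.pi_hyperplane (fun _ : Fin n => (volume : Measure (Fin d → ℝ))) i 0)

end weights

/-! ### Integrability of the derivatives and their vanishing integrals -/

section integrability

variable {𝕜 : Type*} [RCLike 𝕜] {n d : ℕ} {γ : Fin n → ℝ} {u : Pts n d → 𝕜}

theorem sum_single_apply_le {s : ℕ} (c : Fin s → Fin n × Fin d) (i : Fin n) :
    (∑ r, Pi.single (c r).1 1 : Fin n → ℝ) i ≤ s := by
  rw [Finset.sum_apply]
  refine (Finset.sum_le_sum fun r _ => (?_ : _ ≤ (1 : ℝ))).trans (by simp)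
  rw [Pi.single_apply]
  split_ifs <;> norm_num

theorem lt_sub_sum_single {γmin : ℝ} (hγ : ∀ i, γmin ≤ γ i) {s : ℕ} (c : Fin s → Fin n × Fin d)
    (hs : (s : ℝ) < d + γmin) (i : Fin n) :
    -(d : ℝ) < (γ - ∑ r, Pi.single (c r).1 1 : Fin n → ℝ) i := by
  have h1 := sum_single_apply_le c i
  have h2 := hγ i
  rw [Pi.sub_apply]
  linarith

/-- The sequence of scales used to exhaust the complement of the singular set. -/
noncomputable def scale (m : ℕ) : ℝ := 1 / ((m : ℝ) + 3)

theorem scale_pos (m : ℕ) : 0 < scale m := by unfold scale; positivity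

theorem scale_lt (m : ℕ) : scale m < 1 / 2 := by
  have : (0 : ℝ) ≤ m := by positivity
  unfold scale
  rw [div_lt_div_iff₀ (by positivity) (by norm_num)]
  linarith

theorem tendsto_scale : Tendsto scale atTop (nhds 0) := by
  unfold scale
  simpa using (tendsto_natCast_atTop_atTop.atTop_add
    (tendsto_const_nhds (x := (3 : ℝ)))).const_div_atTop (1 : ℝ)

theorem tendsto_mixedPartial_cutProd {s : ℕ} (c : Fin s → Fin n × Fin d) {X : Pts n d}
    (hX : X ∈ offSing n d) :
    Tendsto (fun m => mixedPartial c (cutProd u (scale m)) X) atTop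
      (nhds (mixedPartial c u X)) := by
  have hsmall : ∀ᶠ m in atTop, ∀ i, scale m < ‖X i‖ :=
    eventually_all.2 fun i => tendsto_scale.eventually_lt_const (norm_pos_iff.2 (hX i))
  refine tendsto_const_nhds.congr' ?_
  filter_upwards [hsmall] with m hm
  have hev : ∀ᶠ Y : Pts n d in nhds X, ∀ i, scale m < ‖Y i‖ :=
    eventually_all.2 fun i => (continuous_apply i).norm.continuousAt.eventually_const_lt (hm i)
  have : cutProd u (scale m) =ᶠ[nhds X] u := by
    filter_upwards [hev] with Y hY
    simp [cutProd, cutoff_eq_one (scale_pos m) fun i => (hY i).le]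
  rw [mixedPartial, mixedPartial, (this.iteratedFDeriv ℝ s).eq_of_nhds]

/-- The mixed partial derivatives of the cut off functions are dominated by one integrable weight,
and converge to the mixed partial derivative of `u`. -/
theorem exists_dominated_mixedPartial (hd : 0 < d)
    (hu : ∀ k, IsSymbol k γ fun _ : Set.Ioi (0 : ℝ) => u) {γmin : ℝ} (hγ : ∀ i, γmin ≤ γ i) {s : ℕ}
    (c : Fin s → Fin n × Fin d) (hs : (s : ℝ) < d + γmin) :
    ∃ b : Pts n d → ℝ, IntegrableOn b (cubeV n d) ∧
      (∀ m, ∀ᵐ X ∂volume.restrict (cubeV n d), ‖mixedPartial c (cutProd u (scale m)) X‖ ≤ b X) ∧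
      (∀ᵐ X ∂volume.restrict (cubeV n d), ‖mixedPartial c u X‖ ≤ b X) ∧
      ∀ᵐ X ∂volume.restrict (cubeV n d),
        Tendsto (fun m => mixedPartial c (cutProd u (scale m)) X) atTop
          (nhds (mixedPartial c u X)) := by
  obtain ⟨C, hC, hb⟩ := (isSymbol_cutProd (hu s)).exists_mixedPartial_le c
  have hmem : ∀ᵐ X ∂volume.restrict (cubeV n d), X ∈ cubeV n d ∧ X ∈ offSing n d :=
    (ae_restrict_mem measurableSet_cubeV).and (ae_restrict_of_ae (ae_mem_offSing hd))
  refine ⟨fun X => C * blockWeight (γ - ∑ r, Pi.single (c r).1 1) X,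
    (integrableOn_blockWeight hd (lt_sub_sum_single hγ c hs)).const_mul C, fun m => ?_, ?_, ?_⟩
  · filter_upwards [hmem] with X hX
    exact hb ⟨scale m, Set.mem_Ioi.2 (scale_pos m)⟩ X hX.1 hX.2
  · filter_upwards [hmem] with X hX
    exact le_of_tendsto (tendsto_mixedPartial_cutProd c hX.2).norm
      (Eventually.of_forall fun m => hb ⟨scale m, Set.mem_Ioi.2 (scale_pos m)⟩ X hX.1 hX.2)
  · filter_upwards [hmem] with X hX
    exact tendsto_mixedPartial_cutProd c hX.2

theorem continuous_mixedPartial_cutProd (hu : ContDiffOn ℝ ∞ u (offSing n d)) {s : ℕ}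
    (c : Fin s → Fin n × Fin d) {ε : ℝ} (hε : 0 < ε) :
    Continuous (mixedPartial c (cutProd u ε)) :=
  (contDiff_mixedPartial c (contDiff_cutProd hu hε)).continuous

theorem integrableOn_mixedPartial (hd : 0 < d)
    (hu : ∀ k, IsSymbol k γ fun _ : Set.Ioi (0 : ℝ) => u) {γmin : ℝ} (hγ : ∀ i, γmin ≤ γ i) {s : ℕ}
    (c : Fin s → Fin n × Fin d) (hs : (s : ℝ) < d + γmin) :
    IntegrableOn (mixedPartial c u) (cubeV n d) := by
  obtain ⟨b, hb, -, hle, hlim⟩ := exists_dominated_mixedPartial hd hu hγ c hs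
  refine Integrable.mono' hb ?_ hle
  exact aestronglyMeasurable_of_tendsto_ae atTop (fun m =>
    (continuous_mixedPartial_cutProd ((hu 0).contDiffOn ⟨1, Set.mem_Ioi.2 one_pos⟩) c
      (scale_pos m)).aestronglyMeasurable) hlim

theorem integral_mixedPartial_cutProd_eq_zero (hu : ContDiffOn ℝ ∞ u (offSing n d))
    (hper : PeriodicBoundary u) {s : ℕ} (hs : 1 ≤ s) (c : Fin s → Fin n × Fin d) {ε : ℝ}
    (hε : 0 < ε) (hε2 : ε < 1 / 2) :
    ∫ X in cubeV n d, mixedPartial c (cutProd u ε) X = 0 := by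
  obtain ⟨s, rfl⟩ : ∃ t, s = t + 1 := ⟨s - 1, by omega⟩
  have hcut := contDiff_cutProd hu hε
  rw [mixedPartial_succ_left c hcut]
  exact integral_dirDeriv_cubeV_eq_zero (contDiff_mixedPartial _ hcut)
    (ptsFaceMatch_mixedPartial_cutProd hu hper hε hε2 _ _)

theorem integral_mixedPartial_eq_zero (hd : 0 < d)
    (hu : ∀ k, IsSymbol k γ fun _ : Set.Ioi (0 : ℝ) => u) (hper : PeriodicBoundary u) {γmin : ℝ}
    (hγ : ∀ i, γmin ≤ γ i) {s : ℕ} (hs1 : 1 ≤ s) (c : Fin s → Fin n × Fin d)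
    (hs : (s : ℝ) < d + γmin) :
    ∫ X in cubeV n d, mixedPartial c u X = 0 := by
  obtain ⟨b, hb, hle, -, hlim⟩ := exists_dominated_mixedPartial hd hu hγ c hs
  have hsm := (hu 0).contDiffOn ⟨1, Set.mem_Ioi.2 one_pos⟩
  have h := tendsto_integral_of_dominated_convergence b (fun m =>
    (continuous_mixedPartial_cutProd hsm c (scale_pos m)).aestronglyMeasurable) hb hle hlim
  simp only [integral_mixedPartial_cutProd_eq_zero hsm hper hs1 c (scale_pos _) (scale_lt _)] at h
  exact tendsto_nhds_unique h tendsto_const_nhds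

end integrability

/-! ### The quadrature error -/

section error

variable {𝕜 : Type*} [RCLike 𝕜] {n d : ℕ} {γ : Fin n → ℝ} {u : Pts n d → 𝕜}

theorem exists_integral_sub_cutProd_le (hd : 0 < d)
    (hu : ∀ k, IsSymbol k γ fun _ : Set.Ioi (0 : ℝ) => u) (hγ : ∀ i, -(d : ℝ) < γ i) :
    ∃ C : Fin n → ℝ, ∀ ε : ℝ, 0 < ε →
      ‖(∫ X in cubeV n d, u X) - ∫ X in cubeV n d, cutProd u ε X‖ ≤ ∑ i, C i * ε ^ (γ i + d) := by
  obtain ⟨-, C, hC, hb⟩ := (hu 0).weightBound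
  have hint : IntegrableOn u (cubeV n d) := by
    obtain ⟨γ₀, h₀, h₁⟩ : ∃ γ₀ : ℝ, (0 : ℝ) < d + γ₀ ∧ ∀ i, γ₀ ≤ γ i := by
      rcases isEmpty_or_nonempty (Fin n) with h | h
      · exact ⟨0, by simpa using hd, fun i => h.elim i⟩
      · obtain ⟨i, hi⟩ := Finite.exists_min γ
        exact ⟨γ i, by linarith [hγ i], hi⟩
    have := integrableOn_mixedPartial hd hu h₁ (s := 0) Fin.elim0 (by simpa using h₀)
    rwa [mixedPartial_zero] at this
  choose K hK hnear using fun i => exists_integral_blockWeight_near_le hd hγ i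
  refine ⟨fun i => C * K i, fun ε hε => ?_⟩
  have hcut : IntegrableOn (cutProd u ε) (cubeV n d) :=
    (contDiff_cutProd ((hu 0).contDiffOn ⟨1, Set.mem_Ioi.2 one_pos⟩) hε).continuous.continuousOn.integrableOn_compact
      isCompact_cubeV
  have hmeas : ∀ i, MeasurableSet {X : Pts n d | ‖X i‖ < ε} := fun i =>
    (isOpen_lt (continuous_apply i).norm continuous_const).measurableSet
  have hbw := integrableOn_blockWeight hd hγ
  have hmem : ∀ᵐ X ∂volume.restrict (cubeV n d), X ∈ cubeV n d ∧ X ∈ offSing n d :=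
    (ae_restrict_mem measurableSet_cubeV).and (ae_restrict_of_ae (ae_mem_offSing hd))
  have hind : ∀ i, IntegrableOn
      ({X : Pts n d | ‖X i‖ < ε}.indicator fun X => C * blockWeight γ X) (cubeV n d) := fun i =>
    (hbw.const_mul C).indicator (hmeas i)
  rw [← integral_sub hint hcut]
  calc ‖∫ X in cubeV n d, u X - cutProd u ε X‖
      ≤ ∫ X in cubeV n d, ∑ i,
          {X : Pts n d | ‖X i‖ < ε}.indicator (fun X => C * blockWeight γ X) X := by
        refine norm_integral_le_of_norm_le (integrable_finsetSum _ fun i _ => hind i) ?_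
        filter_upwards [hmem] with X hX
        have hnn : ∀ i, 0 ≤ {X : Pts n d | ‖X i‖ < ε}.indicator (fun X => C * blockWeight γ X) X :=
          fun i => Set.indicator_nonneg (fun X _ => mul_nonneg hC (blockWeight_nonneg _ _)) _
        by_cases h : ∃ i, ‖X i‖ < ε
        · obtain ⟨i, hi⟩ := h
          refine le_trans ?_ (Finset.single_le_sum (fun i _ => hnn i) (Finset.mem_univ i))
          rw [Set.indicator_of_mem (show X ∈ {X : Pts n d | ‖X i‖ < ε} from hi)]
          refine le_trans ?_ (hb ⟨1, Set.mem_Ioi.2 one_pos⟩ X hX.1 hX.2)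
          have : u X - cutProd u ε X = u X * ((1 - cutoff ε X : ℝ) : 𝕜) := by
            simp only [cutProd]; push_cast; ring
          rw [this, norm_mul, RCLike.norm_ofReal, abs_of_nonneg (sub_nonneg.2 (cutoff_le_one ε X))]
          exact mul_le_of_le_one_right (norm_nonneg _) (sub_le_self _ (cutoff_nonneg ε X))
        · push Not at h
          simp only [cutProd, cutoff_eq_one hε h, RCLike.ofReal_one, mul_one, sub_self, norm_zero]
          exact Finset.sum_nonneg fun i _ => hnn i
    _ = ∑ i, C * ∫ X in cubeV n d ∩ {X | ‖X i‖ < ε}, blockWeight γ X := by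
        rw [integral_finsetSum _ fun i _ => hind i]
        refine Finset.sum_congr rfl fun i _ => ?_
        rw [setIntegral_indicator (hmeas i), integral_const_mul]
    _ ≤ ∑ i, C * K i * ε ^ (γ i + d) := by
        refine Finset.sum_le_sum fun i _ => ?_
        rw [mul_assoc]
        exact mul_le_mul_of_nonneg_left (hnear i ε hε) hC

/-- High order pure derivatives of the cut off function concentrate near the singularity. -/
theorem exists_integral_iterate_dirDeriv_le (hd : 0 < d)
    (hu : ∀ k, IsSymbol k γ fun _ : Set.Ioi (0 : ℝ) => u) (hγ : ∀ i, -(d : ℝ) < γ i) {N : ℕ}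
    (c : Fin n × Fin d) (hN : γ c.1 + d < N) :
    ∃ C : ℝ, ∀ ε : ℝ, 0 < ε →
      ∫ X in cubeV n d, ‖(dirDeriv (unitVec c))^[N] (cutProd u ε) X‖
        ≤ C * (ε / 2) ^ (γ c.1 + d - N) := by
  obtain ⟨C, hC, hb⟩ := (isSymbol_cutProd (hu N)).exists_mixedPartial_le fun _ : Fin N => c
  set e : Fin n → ℝ := γ - ∑ _r : Fin N, Pi.single c.1 1 with he
  have hec : e c.1 = γ c.1 - N := by simp [he]
  have hej : ∀ j, j ≠ c.1 → e j = γ j := fun j hj => by simp [he, hj]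
  obtain ⟨K, hK, hfar⟩ := exists_integral_blockWeight_far_le hd (e := e) (i := c.1)
    (by rw [hec]; linarith) (fun j hj => by rw [hej j hj]; exact hγ j)
  refine ⟨C * K, fun ε hε => ?_⟩
  obtain ⟨hint, hle⟩ := hfar (ε / 2) (by positivity)
  have hsm := (hu 0).contDiffOn ⟨1, Set.mem_Ioi.2 one_pos⟩
  rw [iterate_dirDeriv_eq_mixedPartial c (contDiff_cutProd hsm hε)]
  have hcont := (continuous_mixedPartial_cutProd hsm (fun _ : Fin N => c) hε).norm
  have hmeas : MeasurableSet {X : Pts n d | ε / 2 ≤ ‖X c.1‖} :=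
    (isClosed_le continuous_const (continuous_apply c.1).norm).measurableSet
  have hzero : ∀ X ∈ cubeV n d \ (cubeV n d ∩ {X | ε / 2 ≤ ‖X c.1‖}),
      ‖mixedPartial (fun _ : Fin N => c) (cutProd u ε) X‖ = 0 := by
    intro X hX
    have hlt : ‖X c.1‖ < ε / 2 := by
      by_contra h
      exact hX.2 ⟨hX.1, not_lt.1 h⟩
    have hnear : ∀ᶠ Y : Pts n d in nhds X, ‖Y c.1‖ < ε / 2 :=
      (continuous_apply c.1).norm.continuousAt.eventually_lt_const hlt
    have hev : cutProd u ε =ᶠ[nhds X] fun _ => 0 := by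
      filter_upwards [hnear] with Y hY
      simp [cutProd, cutoff_eq_zero hε (le_of_lt hY)]
    rw [mixedPartial, (hev.iteratedFDeriv ℝ N).eq_of_nhds]
    simp
  rw [setIntegral_eq_of_subset_of_forall_sdiff_eq_zero measurableSet_cubeV
    Set.inter_subset_left hzero]
  calc _ ≤ ∫ X in cubeV n d ∩ {X | ε / 2 ≤ ‖X c.1‖}, C * blockWeight e X := by
        refine integral_mono_ae ?_ (hint.const_mul C) ?_
        · exact (hcont.continuousOn.integrableOn_compact isCompact_cubeV).mono_set
            Set.inter_subset_left
        · filter_upwards [ae_restrict_mem (measurableSet_cubeV.inter hmeas),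
            ae_restrict_of_ae (ae_mem_offSing hd)] with X hX hX'
          exact hb ⟨ε, Set.mem_Ioi.2 hε⟩ X hX.1 hX'
    _ = C * ∫ X in cubeV n d ∩ {X | ε / 2 ≤ ‖X c.1‖}, blockWeight e X := integral_const_mul _ _
    _ ≤ C * (K * (ε / 2) ^ (e c.1 + d)) := mul_le_mul_of_nonneg_left hle hC
    _ = _ := by rw [hec, mul_assoc]; congr 3; ring

/-- The distance of `z + t`, for `z` an integer, to zero is bounded below unless it is zero. -/
theorem exists_le_abs_int_add (t : ℝ) : ∃ κ > 0, ∀ z : ℤ, (z : ℝ) + t = 0 ∨ κ ≤ |(z : ℝ) + t| := by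
  have hf0 := Int.fract_nonneg t
  have hf1 := Int.fract_lt_one t
  have hdec : ∀ z : ℤ, (z : ℝ) + t = ((z + ⌊t⌋ : ℤ) : ℝ) + Int.fract t := fun z => by
    rw [Int.cast_add, add_assoc, Int.floor_add_fract]
  rcases hf0.eq_or_lt with h | h
  · refine ⟨1, one_pos, fun z => ?_⟩
    rw [hdec, ← h, add_zero]
    by_cases hz : z + ⌊t⌋ = 0
    · left; rw [hz]; simp
    · right; exact_mod_cast Int.one_le_abs hz
  · refine ⟨min (Int.fract t) (1 - Int.fract t), lt_min h (sub_pos.2 hf1), fun z => Or.inr ?_⟩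
    rw [hdec]
    rcases le_or_gt 0 (z + ⌊t⌋) with hz | hz
    · have : (0 : ℝ) ≤ ((z + ⌊t⌋ : ℤ) : ℝ) := by exact_mod_cast hz
      exact (min_le_left _ _).trans ((by linarith : _ ≤ _).trans (le_abs_self _))
    · have : ((z + ⌊t⌋ : ℤ) : ℝ) ≤ -1 := by exact_mod_cast Int.le_sub_one_of_lt hz
      exact (min_le_right _ _).trans ((by linarith : _ ≤ _).trans (neg_le_abs _))

/-- The mesh points have every `xᵢ` either zero or at distance at least `κ / m` from zero. -/
theorem exists_meshNode_gap (x : Pts n d) :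
    ∃ κ : ℝ, 0 < κ ∧ κ ≤ 1 / 4 ∧ ∀ m : ℕ, 0 < m → ∀ (j : Fin n → Fin d → Fin m) (i : Fin n),
      meshNode x j i = 0 ∨ κ / m ≤ ‖meshNode x j i‖ := by
  choose κ hκ hgap using fun c : Fin n × Fin d => exists_le_abs_int_add (2 * x c.1 c.2)
  obtain ⟨κ₀, h0, hle⟩ : ∃ κ₀ > 0, ∀ c, κ₀ ≤ κ c := by
    rcases isEmpty_or_nonempty (Fin n × Fin d) with h | h
    · exact ⟨1, one_pos, fun c => h.elim c⟩
    · obtain ⟨c, hc⟩ := Finite.exists_min κ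
      exact ⟨κ c, hκ c, hc⟩
  refine ⟨min (κ₀ / 2) (1 / 4), by positivity, min_le_right _ _, fun m hm j i => ?_⟩
  have hmR : (0 : ℝ) < m := by exact_mod_cast hm
  by_cases h : ∀ k, meshNode x j i k = 0
  · exact Or.inl (funext h)
  · obtain ⟨k, hk⟩ := not_forall.1 h
    refine Or.inr (le_trans ?_ (norm_le_pi_norm _ k))
    -- Up to the factor `2m`, the coordinates lie in `ℤ + 2 xᵢₖ`, for both parities of `m`.
    have hval : meshNode x j i k
        = ((((2 * (j i k : ℕ) - m : ℤ)) : ℝ) + 2 * x i k) / (2 * m) := by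
      unfold meshNode
      push_cast
      field_simp
      ring
    rcases hgap (i, k) (2 * (j i k : ℕ) - m : ℤ) with h1 | h1
    · exact absurd (by rw [hval, h1, zero_div]) hk
    · rw [hval, Real.norm_eq_abs, abs_div, abs_of_pos (by positivity : (0 : ℝ) < 2 * m),
        div_le_div_iff₀ hmR (by positivity)]
      have h2 := (hle (i, k)).trans h1
      have h3 : min (κ₀ / 2) (1 / 4) ≤ κ₀ / 2 := min_le_left _ _
      nlinarith

/-- At scales below the distance of the nonzero mesh points to zero, the trapezoidal rule that
omits the singular mesh points is the trapezoidal rule for the cut off function. -/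
theorem trapezoidalRule_cutProd (u : Pts n d → 𝕜) {m : ℕ} {x : Pts n d} {ε : ℝ} (hε : 0 < ε)
    (h : ∀ (j : Fin n → Fin d → Fin m) (i : Fin n),
      meshNode x j i = 0 ∨ ε ≤ ‖meshNode x j i‖) :
    trapezoidalRule m x (zeroAtSingular u) = trapezoidalRule m x (cutProd u ε) := by
  unfold trapezoidalRule
  congr 1
  refine Finset.sum_congr rfl fun j _ => ?_
  unfold zeroAtSingular
  split_ifs with hs
  · obtain ⟨i, hi⟩ := hs
    rw [cutProd, cutoff_eq_zero hε (i := i) (by rw [hi, norm_zero]; positivity)]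
    simp
  · rw [cutProd, cutoff_eq_one hε fun i => (h j i).resolve_left fun hi => hs ⟨i, hi⟩]
    simp

/-- The quadrature error is `O(m ^ (-(d + γmin)))`. -/
theorem exists_quadratureError_le (hd : 0 < d)
    (hu : ∀ k, IsSymbol k γ fun _ : Set.Ioi (0 : ℝ) => u) (hper : PeriodicBoundary u)
    (hγd : ∀ i, -(d : ℝ) < γ i) {γmin : ℝ} (hγ : ∀ i, γmin ≤ γ i) {x : Pts n d}
    (hx : ∀ i k, x i k ∈ Set.Icc (0 : ℝ) 1) :
    ∃ C : ℝ, ∀ m : ℕ, 0 < m → ‖quadratureError m x u‖ ≤ C * (m : ℝ) ^ (-((d : ℝ) + γmin)) := by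
  -- `N > n d` makes the lattice sum converge, `N > γᵢ + d` makes the singularity dominate.
  obtain ⟨N, hNnd, hN⟩ : ∃ N : ℕ, n * d < N ∧ ∀ i, γ i + d < N := by
    obtain ⟨N₁, hN₁⟩ := exists_nat_gt (∑ i, |γ i + d|)
    refine ⟨max (n * d + 1) N₁, lt_max_of_lt_left (Nat.lt_succ_self _), fun i => ?_⟩
    refine lt_of_lt_of_le (lt_of_le_of_lt ?_ hN₁) (by exact_mod_cast le_max_right _ _)
    exact (le_abs_self _).trans
      (Finset.single_le_sum (f := fun i => |γ i + d|) (fun _ _ => abs_nonneg _) (Finset.mem_univ i))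
  -- `κ ≤ 1/4` keeps the cutoff away from the boundary of the cube.
  obtain ⟨κ, hκ, hκ4, hgap⟩ := exists_meshNode_gap x
  obtain ⟨A, hA⟩ := exists_integral_sub_cutProd_le hd hu hγd
  obtain ⟨B, hB, htrap⟩ := exists_trapezoidalRule_error_le (n := n) (d := d) 𝕜 hNnd
  choose D hD using fun c : Fin n × Fin d =>
    exists_integral_iterate_dirDeriv_le hd hu hγd c (hN c.1)
  have hsm := (hu 0).contDiffOn ⟨1, Set.mem_Ioi.2 one_pos⟩
  refine ⟨(∑ i, |A i| * κ ^ (γ i + d)) + B * ∑ c : Fin n × Fin d, |D c| * (κ / 2) ^ (γ c.1 + d - N),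
    fun m hm => ?_⟩
  have hmR : (0 : ℝ) < m := by exact_mod_cast hm
  have hm1 : (1 : ℝ) ≤ m := by exact_mod_cast hm
  have hε : 0 < κ / m := by positivity
  have hε2 : κ / m < 1 / 2 :=
    (div_le_self hκ.le hm1).trans_lt (hκ4.trans_lt (by norm_num))
  have hpow : ∀ i, (m : ℝ) ^ (-(γ i + d)) ≤ (m : ℝ) ^ (-((d : ℝ) + γmin)) := fun i =>
    Real.rpow_le_rpow_of_exponent_le hm1 (by linarith [hγ i])
  have h1 : ‖(∫ X in cubeV n d, u X) - ∫ X in cubeV n d, cutProd u (κ / m) X‖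
      ≤ (∑ i, |A i| * κ ^ (γ i + d)) * (m : ℝ) ^ (-((d : ℝ) + γmin)) := by
    refine (hA _ hε).trans ?_
    rw [Finset.sum_mul]
    refine Finset.sum_le_sum fun i _ => ?_
    rw [Real.div_rpow hκ.le hmR.le, div_eq_mul_inv, ← Real.rpow_neg hmR.le, ← mul_assoc]
    have : A i * κ ^ (γ i + d) ≤ |A i| * κ ^ (γ i + d) := by gcongr; exact le_abs_self _
    exact mul_le_mul this (hpow i) (by positivity) (by positivity)
  have h2 : ‖(∫ X in cubeV n d, cutProd u (κ / m) X) - trapezoidalRule m x (cutProd u (κ / m))‖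
      ≤ (B * ∑ c : Fin n × Fin d, |D c| * (κ / 2) ^ (γ c.1 + d - N))
        * (m : ℝ) ^ (-((d : ℝ) + γmin)) := by
    have hcut := contDiff_cutProd hsm hε
    refine (htrap _ hcut (fun c j => ?_) m hm x hx).trans ?_
    · rw [iterate_dirDeriv_eq_mixedPartial c hcut]
      exact ptsFaceMatch_mixedPartial_cutProd hsm hper hε hε2 _ _
    · rw [mul_assoc, mul_assoc]
      refine mul_le_mul_of_nonneg_left ?_ hB
      rw [Finset.mul_sum, Finset.sum_mul]
      refine Finset.sum_le_sum fun c _ => ?_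
      have hsplit : (κ / m / 2) ^ (γ c.1 + d - N)
          = (κ / 2) ^ (γ c.1 + d - N) * ((m : ℝ) ^ (-(γ c.1 + d)) * (m : ℝ) ^ N) := by
        rw [div_right_comm, Real.div_rpow (by positivity) hmR.le, div_eq_mul_inv,
          ← Real.rpow_neg hmR.le, ← Real.rpow_natCast, ← Real.rpow_add hmR]
        congr 2
        ring
      have hDc := hD c _ hε
      rw [hsplit] at hDc
      have habs : D c ≤ |D c| := le_abs_self _
      calc ((m : ℝ) ^ N)⁻¹ * ∫ X in cubeV n d, ‖(dirDeriv (unitVec c))^[N] (cutProd u (κ / m)) X‖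
          ≤ ((m : ℝ) ^ N)⁻¹ * (|D c| * ((κ / 2) ^ (γ c.1 + d - N)
              * ((m : ℝ) ^ (-(γ c.1 + d)) * (m : ℝ) ^ N))) := by
            refine mul_le_mul_of_nonneg_left (hDc.trans ?_) (by positivity)
            exact mul_le_mul_of_nonneg_right habs (by positivity)
        _ = |D c| * (κ / 2) ^ (γ c.1 + d - N) * (m : ℝ) ^ (-(γ c.1 + d)) := by
            field_simp
        _ ≤ _ := mul_le_mul_of_nonneg_left (hpow c.1) (by positivity)
  rw [quadratureError, trapezoidalRule_cutProd u hε (hgap m hm), add_mul]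
  calc _ = ‖((∫ X in cubeV n d, u X) - ∫ X in cubeV n d, cutProd u (κ / m) X)
        + ((∫ X in cubeV n d, cutProd u (κ / m) X) - trapezoidalRule m x (cutProd u (κ / m)))‖ := by
        rw [sub_add_sub_cancel]
    _ ≤ _ := (norm_add_le _ _).trans (add_le_add h1 h2)

end error

/-- The symbol estimates for the fractional form, with exponents `γᵢ = aᵢ - 2 pᵢ`. -/
theorem isSymbol_fractionalForm {𝕜 : Type*} [RCLike 𝕜] {n d : ℕ} {P : Type*}
    {f : Fin n → Pts n d → 𝕜} {a : Fin n → ℕ} {p : Fin n → ℝ} {M : Matrix (Fin d) (Fin d) ℝ}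
    (hM : M.PosDef) (hsmooth : ∀ i, ContDiff ℝ ∞ (f i)) (hf : ∀ i, VanishOrder i (a i) (f i))
    (k : ℕ) :
    IsSymbol k (fun i => (a i : ℝ) - 2 * p i) fun _ : P => fractionalForm f M p := by
  have h := IsSymbol.prod (k := k) Finset.univ fun i _ =>
    ((hf i).isSymbol (P := P) (hsmooth i) k).mul
      ((isSymbol_quadForm_rpow (n := n) (P := P) hM i (-p i) k).clm_comp (RCLike.ofRealCLM (K := 𝕜)))
  have he : ∑ i, (Pi.single i (a i : ℝ) + Pi.single i (2 * -p i) : Fin n → ℝ)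
      = fun i => (a i : ℝ) - 2 * p i := by
    funext j
    simp only [← Pi.single_add]
    rw [Finset.univ_sum_single]
    ring
  rw [he] at h
  refine h.congr fun _ X hX => ?_
  refine Finset.prod_congr rfl fun i _ => ?_
  change f i X / ((quadForm M i X ^ p i : ℝ) : 𝕜) = _
  rw [div_eq_mul_inv, ← RCLike.ofReal_inv, ← Real.rpow_neg (quadForm_pos (i := i) hM hX).le]
  rfl

theorem mainTheorem2 {𝕜 : Type*} [RCLike 𝕜] (n d : ℕ) (hn : 0 < n) (hd : 0 < d)
    (f : Fin n → Pts n d → 𝕜) (a : Fin n → ℕ) (p : Fin n → ℝ)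
    (M : Matrix (Fin d) (Fin d) ℝ) (hM : M.PosDef)
    (hsmooth : ∀ i, ContDiff ℝ ∞ (f i))
    (hanalytic : ∀ i X, AnalyticAt ℝ (fun y : Fin d → ℝ => f i (Function.update X i y)) 0)
    (horder : ∀ i X, (fun y : Fin d → ℝ => f i (Function.update X i y))
      =O[nhds 0] (fun y : Fin d → ℝ => ‖WithLp.toLp 2 y‖ ^ (a i)))
    (γ : Fin n → ℝ) (hγ : ∀ i, γ i = (a i : ℝ) - 2 * p i) (hγd : ∀ i, -(d : ℝ) < γ i)
    (γmin : ℝ) (hγmin : IsLeast (Set.range γ) γmin)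
    (hper : PeriodicBoundary (fractionalForm f M p))
    (x : Pts n d) (hx : ∀ i k, x i k ∈ Set.Icc (0 : ℝ) 1) :
    (∀ (s : ℕ) (c : Fin s → Fin n × Fin d), (s : ℝ) < (d : ℝ) + γmin →
      IntegrableOn (mixedPartial c (fractionalForm f M p)) (cubeV n d)) ∧
    (∀ (s : ℕ) (c : Fin s → Fin n × Fin d), 1 ≤ s → (s : ℝ) < (d : ℝ) + γmin →
      ∫ X in cubeV n d, mixedPartial c (fractionalForm f M p) X = 0) ∧
    (fun m : ℕ => quadratureError m x (fractionalForm f M p))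
      =O[atTop] (fun m : ℕ => Real.log (m : ℝ) / (m : ℝ) ^ ((d : ℝ) + γmin)) := by
  have hu : ∀ k, IsSymbol k γ fun _ : Set.Ioi (0 : ℝ) => fractionalForm f M p := fun k => by
    rw [funext hγ]
    exact isSymbol_fractionalForm hM hsmooth
      (fun i => vanishOrder_of_isBigO (hsmooth i) (hanalytic i) (horder i)) k
  have hmin : ∀ i, γmin ≤ γ i := fun i => hγmin.2 ⟨i, rfl⟩
  refine ⟨fun s c hs => integrableOn_mixedPartial hd hu hmin c hs,
    fun s c hs1 hs => integral_mixedPartial_eq_zero hd hu hper hmin hs1 c hs, ?_⟩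
  obtain ⟨C, hC⟩ := exists_quadratureError_le hd hu hper hγd hmin hx
  refine IsBigO.of_bound |C| ?_
  filter_upwards [eventually_ge_atTop 3] with m hm
  have hmR : (3 : ℝ) ≤ m := by exact_mod_cast hm
  -- The logarithm only has to be bounded below.
  have hlog : 1 ≤ Real.log m := by
    rw [Real.le_log_iff_exp_le (by linarith)]
    exact (Real.exp_one_lt_d9.le.trans (by norm_num)).trans hmR
  refine (hC m (by omega)).trans ?_
  rw [Real.norm_of_nonneg (by positivity), Real.rpow_neg (by positivity), div_eq_mul_inv]
  refine mul_le_mul (le_abs_self C) ?_ (by positivity) (abs_nonneg C)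
  exact le_mul_of_one_le_left (by positivity) hlog
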